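/- **Queries.** Let $\varphi(\mathbf{x}_F)\leftarrow\bigoplus_{\mathbf{x}_{[n]\setminus F}}\bigotimes_{J\in\mathcal E}R_J(\mathbf{x}_J)$ be a functional aggregate query (FAQ) with hypergraph $\mathcal H=([n],\mathcal E)$ and head $F\subseteq[n]$, in which every variable occurs in some $J\in\mathcal E$. It is evaluated over the tropical semiring $(\mathbb R_+\cup\{\infty\},\min,+,\infty,0)$. A database $D=(R_J)_{J\in\mathcal E}$ consists of finite annotated relations (tuples that are not in $R_J$ have annotation $\infty$), $|D|$ is its total number of tuples, and $|\mathrm{OUT}|$ is the number of tuples with finite annotation in $\varphi(D)$. **Clique embeddings.** Let $k\ge 3$ and let $\psi$ be a $k$-clique embedding of the hypergraph $\mathcal H'=([n],\mathcal E\cup\{F\})$. This means that each $v\in\{1,\dots,k\}$ is mapped to a nonempty set $\psi(v)\subseteq[n]$ that induces a connected subgraph, and for all $u\ne v$ the sets $\psi(u),\psi(v)$ intersect or some hyperedge of $\mathcal H'$ meets both. For $J\subseteq[n]$ put $d_\psi(J)=|\{v:\psi(v)\cap J\neq\emptyset\}|$ and $d^+_\psi(J)=\sum_{i\in J}d_\psi(\{i\})$.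 Put $\mathsf{wed}^F(\psi)=\max_{J\in\mathcal E}d_\psi(J)$, the maximum over all hyperedges of $\mathcal H'$ other than the added hyperedge $F$ (if $F$ is itself one of the hyperedges in $\mathcal E$, it counts). **Computation.** Algorithms are deterministic programs for the uniform-cost RAM with arithmetic $+,-,\cdot,/$. On inputs of size $N$ the registers hold integers of $O(\log N)$ bits. The numbers in the input are integers of absolute value at most $(N+2)^c$, where $c$ is an arbitrary constant on which the program may depend: these are natural-number constants and annotations for databases, with $N=|D|$, and integer edge weights for $N$-node graphs. A database is given as lists of the tuples of its relations in arbitrary order. The output is the list of all tuples of $\varphi(D)$ with their annotations. In time bounds $|D|$, $|\mathrm{OUT}|$ and $N$ are read as at least $1$. The Min-Weight $k$-Clique Conjecture for $k$ states that there is no real $\epsilon>0$ such that the minimum weight of a $k$-clique in an undirected $N$-node graph with integer edge weights ($\infty$ if there is no $k$-clique) can be computed in time $O(N^{k-\epsilon})$. **Theorem.** Let $x,y>0$ be reals with $$x\cdot\mathsf{wed}^F(\psi)+y\cdot d^+_\psi(F)\le k,$$ and let $\epsilon,\epsilon'\ge 0$ be reals with $\epsilon+\epsilon'>0$, and with $\epsilon>0$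 in the case $d^+_\psi(F)=0$. Then, assuming the Min-Weight $k$-Clique Conjecture for this $k$, no algorithm (combinatorial or not) evaluates $\varphi(D)$ over the tropical semiring, for all databases $D$, in time $O(|D|^{x-\epsilon}\cdot|\mathrm{OUT}|^{y-\epsilon'})$. -/

import Mathlib

open scoped ENNReal

/-! ### The RAM

A uniform-cost RAM with integer registers, finitely many randomly accessible arrays (those named in
the program), a read-only randomly accessible input and a write-only output. Control flow is
structured. Arithmetic is exact, but no register may ever hold an integer of absolute value larger
than the bound `B`; an instruction that would violate this has no execution. -/

namespace RAM

inductive ArithOp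
  | add | sub | mul | div

def ArithOp.eval : ArithOp → ℤ → ℤ → ℤ
  | .add, a, b => a + b
  | .sub, a, b => a - b
  | .mul, a, b => a * b
  | .div, a, b => a / b

/-- Programs. Registers and arrays are named by natural numbers. -/
inductive Cmd
  /-- `reg r := z` -/
  | const (r : ℕ) (z : ℤ)
  /-- `reg r := reg a ∘ reg b` -/
  | arith (op : ArithOp) (r a b : ℕ)
  /-- `reg r := input[reg a]` -/
  | read (r a : ℕ)
  /-- `reg r := array m [reg a]` -/
  | load (m r a : ℕ)
  /-- `array m [reg a] := reg r` -/
  | store (m a r : ℕ)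
  /-- append `reg r` to the output -/
  | emit (r : ℕ)
  /-- sequential composition -/
  | seq (p q : Cmd)
  /-- if `0 < reg r` then `p` else `q` -/
  | cond (r : ℕ) (p q : Cmd)
  /-- while `0 < reg r` do `p` -/
  | loop (r : ℕ) (p : Cmd)

structure State where
  reg : ℕ → ℤ
  mem : ℕ → ℕ → ℤ
  out : List ℤ

/-- All registers and all arrays contain zeros, and the output is empty. -/
def State.init : State := ⟨fun _ => 0, fun _ _ => 0, []⟩

def State.setReg (s : State) (r : ℕ) (z : ℤ) : State :=
  { s with reg := Function.update s.reg r z }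

def State.setMem (s : State) (m i : ℕ) (z : ℤ) : State :=
  { s with mem := Function.update s.mem m (Function.update (s.mem m) i z) }

/-- `Exec B inp p s t s'`: with register bound `B` and input `inp`, the program `p` started in the
state `s` halts after exactly `t` steps in the state `s'`. -/
inductive Exec (B : ℕ) (inp : List ℤ) : Cmd → State → ℕ → State → Prop
  | const (r : ℕ) (z : ℤ) (s : State) (h : |z| ≤ B) :
      Exec B inp (.const r z) s 1 (s.setReg r z)
  | arith (op : ArithOp) (r a b : ℕ) (s : State) (h : |op.eval (s.reg a) (s.reg b)| ≤ B) :
      Exec B inp (.arith op r a b) s 1 (s.setReg r (op.eval (s.reg a) (s.reg b)))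
  | read (r a : ℕ) (s : State) (ha : 0 ≤ s.reg a)
      (h : |inp.getD (s.reg a).toNat 0| ≤ B) :
      Exec B inp (.read r a) s 1 (s.setReg r (inp.getD (s.reg a).toNat 0))
  | load (m r a : ℕ) (s : State) (ha : 0 ≤ s.reg a) :
      Exec B inp (.load m r a) s 1 (s.setReg r (s.mem m (s.reg a).toNat))
  | store (m a r : ℕ) (s : State) (ha : 0 ≤ s.reg a) :
      Exec B inp (.store m a r) s 1 (s.setMem m (s.reg a).toNat (s.reg r))
  | emit (r : ℕ) (s : State) :
      Exec B inp (.emit r) s 1 { s with out := s.out ++ [s.reg r] }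
  | seq (p q : Cmd) (s s' s'' : State) (t t' : ℕ) (hp : Exec B inp p s t s')
      (hq : Exec B inp q s' t' s'') : Exec B inp (.seq p q) s (t + t') s''
  | cond_pos (r : ℕ) (p q : Cmd) (s s' : State) (t : ℕ) (hr : 0 < s.reg r)
      (hp : Exec B inp p s t s') : Exec B inp (.cond r p q) s (t + 1) s'
  | cond_neg (r : ℕ) (p q : Cmd) (s s' : State) (t : ℕ) (hr : s.reg r ≤ 0)
      (hq : Exec B inp q s t s') : Exec B inp (.cond r p q) s (t + 1) s'
  | loop_done (r : ℕ) (p : Cmd) (s : State) (hr : s.reg r ≤ 0) :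
      Exec B inp (.loop r p) s 1 s
  | loop_step (r : ℕ) (p : Cmd) (s s' s'' : State) (t t' : ℕ) (hr : 0 < s.reg r)
      (hp : Exec B inp p s t s') (hl : Exec B inp (.loop r p) s' t' s'') :
      Exec B inp (.loop r p) s (t + t' + 1) s''

/-- On input `inp` with register bound `B`, the program halts within `T` steps with output `out`. -/
def Computes (B : ℕ) (p : Cmd) (inp out : List ℤ) (T : ℝ) : Prop :=
  ∃ (t : ℕ) (s : State), Exec B inp p State.init t s ∧ (t : ℝ) ≤ T ∧ s.out = out

end RAM

/-! ### Minimum-weight `k`-clique -/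

/-- The weights of the `k`-cliques of `G` (sum of the weights of all edges of the clique). -/
def cliqueWeights {n : ℕ} (G : SimpleGraph (Fin n)) (w : Sym2 (Fin n) → ℤ) (k : ℕ) : Set ℤ :=
  {a | ∃ s : Finset (Fin n), G.IsNClique k s ∧ a = ∑ e ∈ s.sym2 with ¬ e.IsDiag, w e}

open Classical in
/-- `n`, followed by the adjacency matrix, row by row; the entry of `(u, v)` consists of a flag
and the weight of the edge (`0, 0` if there is no edge). -/
noncomputable def encodeGraph {n : ℕ} (G : SimpleGraph (Fin n)) (w : Sym2 (Fin n) → ℤ) : List ℤ :=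
  (n : ℤ) :: (List.finRange n).flatMap fun u => (List.finRange n).flatMap fun v =>
    if G.Adj u v then [1, w s(u, v)] else [0, 0]

/-- `out` is the tropical value of the `k`-clique problem: the minimum weight of a `k`-clique, or
nothing (standing for `∞`) if there is no `k`-clique. -/
def IsMinWeightCliqueOutput {n : ℕ} (G : SimpleGraph (Fin n)) (w : Sym2 (Fin n) → ℤ) (k : ℕ)
    (out : List ℤ) : Prop :=
  (cliqueWeights G w k = ∅ ∧ out = []) ∨ ∃ m, IsLeast (cliqueWeights G w k) m ∧ out = [m]

/-- The `k`-clique problem over the tropical semiring, for `N`-node graphs whose integer edge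
weights fit into `O(log N)` bits, can be solved in time `O(T N)` with registers of `O(log N)`
bits. -/
def MinWeightCliqueInTime (k : ℕ) (T : ℕ → ℝ) : Prop :=
  ∀ c : ℕ, ∃ (P : RAM.Cmd) (d : ℕ) (C : ℝ),
    ∀ (N : ℕ) (G : SimpleGraph (Fin N)) (w : Sym2 (Fin N) → ℤ),
      (∀ e ∈ G.edgeSet, |w e| ≤ ((N + 2) ^ c : ℕ)) →
      ∃ out : List ℤ, RAM.Computes ((N + 2) ^ d) P (encodeGraph G w) out (C * T N) ∧
        IsMinWeightCliqueOutput G w k out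

/-- The Min-Weight `k`-Clique Conjecture (for the given `k`). -/
def MinWeightCliqueConjecture (k : ℕ) : Prop :=
  ¬ ∃ ε : ℝ, 0 < ε ∧ MinWeightCliqueInTime k fun N => (max 1 (N : ℝ)) ^ ((k : ℝ) - ε)

/-! ### Functional aggregate queries -/

/-- A `σ`-relation of schema `J`, with constants from `ℕ`: finitely many tuples have an annotation
different from `0`, and these are the tuples of the relation. -/
abbrev SRelation (σ : Type*) [Zero σ] {n : ℕ} (J : Finset (Fin n)) := (J → ℕ) →₀ σ

/-- The shape of a functional aggregate query
`φ(x_head) ← ⨁_{x_{[n] ∖ head}} ⨂_{J ∈ edges} R_J(x_J)` with variables `Fin n`; every variable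
occurs in some atom. -/
structure FAQ (n : ℕ) where
  edges : Finset (Finset (Fin n))
  head : Finset (Fin n)
  cover : ∀ i, ∃ J ∈ edges, i ∈ J

namespace FAQ

variable {n : ℕ}

abbrev Database (φ : FAQ n) (σ : Type*) [Zero σ] := (J : φ.edges) → SRelation σ J.1

/-- `|D|`: the total number of tuples. -/
def Database.size {φ : FAQ n} {σ : Type*} [Zero σ] (D : φ.Database σ) : ℕ :=
  ∑ J : φ.edges, (D J).support.card

/-- The annotation of the head tuple `t` in the result. -/
noncomputable def value (φ : FAQ n) {σ : Type*} [CommSemiring σ] (D : φ.Database σ)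
    (t : φ.head → ℕ) : σ :=
  ∑ᶠ v ∈ {v : Fin n → ℕ | φ.head.restrict v = t}, ∏ J : φ.edges, D J (J.1.restrict v)

theorem finite_valuations (φ : FAQ n) {σ : Type*} [CommSemiring σ] (D : φ.Database σ) :
    {v : Fin n → ℕ | ∏ J : φ.edges, D J (J.1.restrict v) ≠ 0}.Finite := by
  classical
  choose J hJ hi using φ.cover
  refine (Set.Finite.pi' (t := fun i : Fin n =>
    (fun t : (J i → ℕ) => t ⟨i, hi i⟩) '' ((D ⟨J i, hJ i⟩).support : Set (J i → ℕ)))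
    (fun i => ((D ⟨J i, hJ i⟩).support.finite_toSet).image _)).subset ?_
  intro v hv i
  refine ⟨(J i).restrict v, ?_, rfl⟩
  simp only [Finset.mem_coe, Finsupp.mem_support_iff]
  intro h0
  exact hv (Finset.prod_eq_zero (Finset.mem_univ (⟨J i, hJ i⟩ : φ.edges)) h0)

theorem finite_support_value (φ : FAQ n) {σ : Type*} [CommSemiring σ] (D : φ.Database σ) :
    (Function.support (φ.value D)).Finite := by
  refine ((φ.finite_valuations D).image φ.head.restrict).subset ?_
  intro t ht
  obtain ⟨v, hv⟩ := exists_ne_zero_of_finsum_mem_ne_zero ht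
  exact ⟨v, hv.2, hv.1⟩

/-- The result `φ(D)`, a `σ`-relation over the head variables. -/
noncomputable def eval (φ : FAQ n) {σ : Type*} [CommSemiring σ] (D : φ.Database σ) :
    SRelation σ φ.head :=
  Finsupp.ofSupportFinite (φ.value D) (φ.finite_support_value D)

end FAQ

/-- The tropical semiring `(ℝ₊ ∪ {∞}, min, +, ∞, 0)`. -/
abbrev Trop : Type := Tropical ℝ≥0∞

/-- `L` lists the tuples of `R`, each exactly once, with their annotations, all of which are
natural numbers. -/
def IsListing {n : ℕ} {J : Finset (Fin n)} (L : List ((J → ℕ) × ℕ)) (R : SRelation Trop J) :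
    Prop :=
  (L.map Prod.fst).Nodup ∧ (∀ t, t ∈ L.map Prod.fst ↔ R t ≠ 0) ∧
    ∀ p ∈ L, R p.1 = Tropical.trop (p.2 : ℝ≥0∞)

/-- Row by row: the entries of the tuple in the order of the variables, then the annotation. -/
def encodeRows {n : ℕ} {J : Finset (Fin n)} (L : List ((J → ℕ) × ℕ)) : List ℤ :=
  L.flatMap fun p => List.ofFn (fun i => (p.1 (J.orderIsoOfFin rfl i) : ℤ)) ++ [(p.2 : ℤ)]

/-- The relations one after the other (in a fixed order that depends only on the query), each
preceded by its number of tuples. -/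
noncomputable def encodeDatabase {n : ℕ} {φ : FAQ n}
    (L : (J : φ.edges) → List ((J.1 → ℕ) × ℕ)) : List ℤ :=
  (Finset.univ : Finset φ.edges).toList.flatMap fun J => ((L J).length : ℤ) :: encodeRows (L J)

/-- The query `φ` can be evaluated over the tropical semiring in time `O(T |D| |OUT|)`, on
databases whose constants and annotations fit into `O(log |D|)` bits, with registers of
`O(log |D|)` bits. -/
def FAQ.TropicalInTime {n : ℕ} (φ : FAQ n) (T : ℕ → ℕ → ℝ) : Prop :=
  ∀ c : ℕ, ∃ (P : RAM.Cmd) (d : ℕ) (C : ℝ),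
    ∀ (D : φ.Database Trop) (L : (J : φ.edges) → List ((J.1 → ℕ) × ℕ)),
      (∀ J, IsListing (L J) (D J)) →
      (∀ J, ∀ p ∈ L J, (∀ i, p.1 i ≤ (D.size + 2) ^ c) ∧ p.2 ≤ (D.size + 2) ^ c) →
      ∃ L' : List ((φ.head → ℕ) × ℕ), IsListing L' (φ.eval D) ∧
        RAM.Computes ((D.size + 2) ^ d) P (encodeDatabase L) (encodeRows L')
          (C * T D.size (φ.eval D).support.card)

/-! ### Clique embeddings -/

/-- `X` and `Y` touch in the hypergraph with edge set `E`. -/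
def Touch {n : ℕ} (E : Finset (Finset (Fin n))) (X Y : Finset (Fin n)) : Prop :=
  (X ∩ Y).Nonempty ∨ ∃ e ∈ E, (e ∩ X).Nonempty ∧ (e ∩ Y).Nonempty

/-- Two distinct vertices are adjacent if some hyperedge contains both. -/
def primalGraph {n : ℕ} (E : Finset (Finset (Fin n))) : SimpleGraph (Fin n) where
  Adj u v := u ≠ v ∧ ∃ e ∈ E, u ∈ e ∧ v ∈ e
  symm := ⟨fun _ _ h => ⟨h.1.symm, h.2.imp fun _ he => ⟨he.1, he.2.2, he.2.1⟩⟩⟩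
  loopless := ⟨fun _ h => h.1 rfl⟩

structure IsCliqueEmbedding {n k : ℕ} (E : Finset (Finset (Fin n)))
    (ψ : Fin k → Finset (Fin n)) : Prop where
  nonempty : ∀ v, (ψ v).Nonempty
  connected : ∀ v, ((primalGraph E).induce (ψ v : Set (Fin n))).Connected
  touch : ∀ u v, u ≠ v → Touch E (ψ u) (ψ v)

/-- The weak edge depth `d_ψ(J)`. -/
def weakEdgeDepth {n k : ℕ} (ψ : Fin k → Finset (Fin n)) (J : Finset (Fin n)) : ℕ :=
  (Finset.univ.filter fun v => (ψ v ∩ J).Nonempty).card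

/-- The edge depth `d⁺_ψ(J)`. -/
def edgeDepth {n k : ℕ} (ψ : Fin k → Finset (Fin n)) (J : Finset (Fin n)) : ℕ :=
  ∑ i ∈ J, weakEdgeDepth ψ {i}

/-- The `F`-weak edge depth of `ψ`, as an embedding into the hypergraph of the query `φ` with an
additional hyperedge `F = φ.head`: the maximum of the weak edge depths over all hyperedges other
than the additional one, that is, over the hyperedges of `φ`. -/
def headWeakEdgeDepth {n k : ℕ} (φ : FAQ n) (ψ : Fin k → Finset (Fin n)) : ℕ :=
  φ.edges.sup (weakEdgeDepth ψ)

/-! Minimum-weight `k`-clique is reduced to the query. A candidate clique is an assignment `a` of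
graph vertices to the positions `v : Fin k`, and variable `i` carries the base-`N` number with
digits `a v` for `i ∈ ψ v` (`code`). The relation of a hyperedge `J` of the query has one row per
assignment to the positions that meet `J`, hence `N ^ weakEdgeDepth ψ J` rows. Edge weights are
shifted to be nonnegative, a non-adjacent pair costs `big`, which exceeds the shifted weight of
every clique, and each pair is charged to one hyperedge of the query that meets both its members, if
there is one.

The added hyperedge `F` has no relation, so the join checks neither the pairs that only `F` brings
together nor the agreement of digits across `F`. Both depend on the head tuple alone, so they can be
charged to the answer rows afterwards (`headWeight`, with penalty `big` for a disagreement). An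
assignment yields a row of at most its own weight (`exists_row_le`). Conversely, a row that scores
below `big` has consistent digits on every connected set `ψ v`, and its score is the weight of an
assignment (`exists_pairWeight_eq`). The minimal score, capped by `big`, therefore solves the clique
problem (`isMinWeightCliqueOutput_of_min`). Even without agreement across `F`, head variable `i`
takes at most `N ^ weakEdgeDepth ψ {i}` values, which bounds the output by `N ^ edgeDepth ψ F`
(`card_support_eval_le`).

The exponent of `|D|` may be below 1, so there may be no time to write the database down. It is
never built: the query program is simulated, and each read of its input is replaced by an expression
of constant cost that computes the entry from the graph (`sim_exec`, `accesses_accDatabase`). Its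
output is buffered and scanned, which is cheap because there are no more rows than steps
(`minProgram_exec`). By `time_le` the total is `O(N ^ (k - δ))` for a positive `δ`, against the
conjecture. -/

namespace RAM

/-! ### Expressions and their compilation -/

/-- Arithmetic expressions over four variables, the input and one array. -/
inductive Ex
  | const (z : ℤ)
  | var (i : Fin 4)
  | op (o : ArithOp) (a b : Ex)
  | inp (a : Ex)
  | arr (a : Ex)
  | ite (c a b : Ex)

namespace Ex

/-- The value of an expression; the input and the array are only read at positive positions. -/
def eval (ρ : Fin 4 → ℤ) (μ : ℕ → ℤ) (l : List ℤ) : Ex → ℤ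
  | const z => z
  | var i => ρ i
  | op o a b => o.eval (a.eval ρ μ l) (b.eval ρ μ l)
  | inp a => if 0 < a.eval ρ μ l then l.getD (a.eval ρ μ l).toNat 0 else 0
  | arr a => if 0 < a.eval ρ μ l then μ (a.eval ρ μ l).toNat else 0
  | ite c a b => if 0 < c.eval ρ μ l then a.eval ρ μ l else b.eval ρ μ l

/-- All intermediate values are at most `M ^ deg` if all data are at most `M`. -/
def deg : Ex → ℕ
  | const z => z.natAbs
  | var _ => 1
  | op _ a b => a.deg + b.deg + 1
  | inp a => a.deg + 1
  | arr a => a.deg + 1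
  | ite c a b => c.deg + a.deg + b.deg

/-- An upper bound for the running time of the compiled expression. -/
def cost : Ex → ℕ
  | const _ => 1
  | var _ => 2
  | op _ a b => a.cost + b.cost + 1
  | inp a => a.cost + 2
  | arr a => a.cost + 2
  | ite c a b => c.cost + a.cost + b.cost + 1

/-- Code that computes the expression into register `2 * p`, with variable `i` in register `2 * i`
and the registers `2 * q`, `p ≤ q`, as working space. -/
def compile : Ex → ℕ → Cmd
  | const z, p => .const (2 * p) z
  | var i, p => .seq (.const (2 * p) 0) (.arith .add (2 * p) (2 * i) (2 * p))
  | op o a b, p => .seq (.seq (a.compile p) (b.compile (p + 1)))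
      (.arith o (2 * p) (2 * p) (2 * (p + 1)))
  | inp a, p => .seq (a.compile p) (.cond (2 * p) (.read (2 * p) (2 * p)) (.const (2 * p) 0))
  | arr a, p => .seq (a.compile p) (.cond (2 * p) (.load 0 (2 * p) (2 * p)) (.const (2 * p) 0))
  | ite c a b, p => .seq (c.compile p) (.cond (2 * p) (a.compile p) (b.compile p))

end Ex

/-- The variables of expressions in a state. -/
def State.vars (s : State) : Fin 4 → ℤ := fun i => s.reg (2 * i)

/-- Variables, input and array `0` are bounded by `M`. -/
structure DataBound (M : ℕ) (l : List ℤ) (ρ : Fin 4 → ℤ) (μ : ℕ → ℤ) : Prop where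
  two_le : 2 ≤ M
  vars : ∀ i, |ρ i| ≤ M
  arr : ∀ i, |μ i| ≤ M
  inp : ∀ i, |l.getD i 0| ≤ M

/-- The summand 1 in the exponent pays for the factor 2 in sums and differences, as `2 ≤ M`.
Products need only `m + n`, and integer division does not increase absolute values. -/
theorem ArithOp.abs_eval_le (o : ArithOp) {a b : ℤ} {M m n : ℕ} (hM : 2 ≤ M)
    (ha : |a| ≤ (M : ℤ) ^ m) (hb : |b| ≤ (M : ℤ) ^ n) : |o.eval a b| ≤ (M : ℤ) ^ (m + n + 1) := by
  have hM' : (2 : ℤ) ≤ M := by exact_mod_cast hM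
  have hm : (1 : ℤ) ≤ (M : ℤ) ^ m := one_le_pow₀ (by linarith)
  have hn : (1 : ℤ) ≤ (M : ℤ) ^ n := one_le_pow₀ (by linarith)
  have hmn : (1 : ℤ) ≤ (M : ℤ) ^ m * (M : ℤ) ^ n := by nlinarith
  have h1 : (M : ℤ) ^ m ≤ (M : ℤ) ^ m * (M : ℤ) ^ n := by nlinarith
  have h2 : (M : ℤ) ^ n ≤ (M : ℤ) ^ m * (M : ℤ) ^ n := by nlinarith
  have h3 : (M : ℤ) ^ m * (M : ℤ) ^ n * 2 ≤ (M : ℤ) ^ m * (M : ℤ) ^ n * M :=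
    mul_le_mul_of_nonneg_left hM' (by linarith)
  rw [pow_succ, pow_add]
  cases o with
  | add => exact (abs_add_le a b).trans (by linarith)
  | sub => exact (abs_sub a b).trans (by linarith)
  | mul =>
    have := mul_le_mul ha hb (abs_nonneg b) (by linarith)
    rw [← abs_mul] at this
    exact this.trans (by linarith)
  | div =>
    have : |a / b| ≤ |a| := by
      rw [Int.abs_eq_natAbs, Int.abs_eq_natAbs]
      exact_mod_cast Int.natAbs_ediv_le_natAbs a b
    exact this.trans (by linarith)

/-- The exponent depends on the expression alone, so an `M` polynomial in `N` keeps all intermediate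
values within `O(log N)` bits. -/
theorem Ex.abs_eval_le {M : ℕ} {l : List ℤ} {ρ : Fin 4 → ℤ} {μ : ℕ → ℤ}
    (h : DataBound M l ρ μ) (e : Ex) : |e.eval ρ μ l| ≤ (M : ℤ) ^ e.deg := by
  have hM : (2 : ℤ) ≤ M := by exact_mod_cast h.two_le
  have hpos : ∀ m, (1 : ℤ) ≤ (M : ℤ) ^ m := fun m => one_le_pow₀ (by linarith)
  have hmono : ∀ {m n : ℕ}, m ≤ n → (M : ℤ) ^ m ≤ (M : ℤ) ^ n :=
    fun hmn => pow_le_pow_right₀ (by linarith) hmn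
  have hself : ∀ m, (M : ℤ) ≤ (M : ℤ) ^ (m + 1) := fun m => by
    simpa using hmono (show 1 ≤ m + 1 by omega)
  induction e with
  | const z =>
    rw [eval, deg, Int.abs_eq_natAbs]
    have : z.natAbs ≤ M ^ z.natAbs := (Nat.lt_pow_self (by have := h.two_le; omega)).le
    exact_mod_cast this
  | var i => simpa [eval, deg] using h.vars i
  | op o a b iha ihb => exact o.abs_eval_le h.two_le iha ihb
  | inp a _ =>
    rw [eval, deg]
    split_ifs
    · exact (h.inp _).trans (hself _)
    · simp
  | arr a _ =>
    rw [eval, deg]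
    split_ifs
    · exact (h.arr _).trans (hself _)
    · simp
  | ite c a b _ iha ihb =>
    rw [eval, deg]
    split_ifs
    · exact iha.trans (hmono (by omega))
    · exact ihb.trans (hmono (by omega))

/-- `s'` differs from `s` at most in the registers `2 * q`, `p ≤ q`. -/
structure SameBelow (p : ℕ) (s s' : State) : Prop where
  reg : ∀ r, r < 2 * p ∨ r % 2 = 1 → s'.reg r = s.reg r
  mem : s'.mem = s.mem
  out : s'.out = s.out

theorem SameBelow.trans {p q : ℕ} {s s' s'' : State} (h : SameBelow p s s')
    (h' : SameBelow q s' s'') (hpq : p ≤ q) : SameBelow p s s'' :=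
  ⟨fun r hr => (h'.reg r (by omega)).trans (h.reg r hr), h'.mem.trans h.mem, h'.out.trans h.out⟩

theorem SameBelow.vars {p : ℕ} {s s' : State} (h : SameBelow p s s') (hp : 4 ≤ p) :
    s'.vars = s.vars :=
  funext fun i => h.reg _ (by omega)

theorem SameBelow.setReg (p : ℕ) (s : State) (z : ℤ) : SameBelow p s (s.setReg (2 * p) z) :=
  ⟨fun r hr => Function.update_of_ne (by omega) _ _, rfl, rfl⟩

@[simp] theorem State.reg_setReg_self (s : State) (r : ℕ) (z : ℤ) : (s.setReg r z).reg r = z :=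
  Function.update_self ..

theorem State.reg_setReg (s : State) (r r' : ℕ) (z : ℤ) :
    (s.setReg r z).reg r' = if r' = r then z else s.reg r' :=
  Function.update_apply ..

/-- Register `2 * p` holds the left operand while the right one is computed from `2 * (p + 1)`
upwards. With `4 ≤ p` the variables (registers 0, 2, 4, 6) survive, and odd registers are never
touched; they are reserved for the simulated program. -/
theorem Ex.compile_exec {M B : ℕ} {l : List ℤ} (e : Ex) :
    ∀ (p : ℕ) (s : State), 4 ≤ p → DataBound M l s.vars (s.mem 0) → M ^ e.deg ≤ B →
    ∃ t s', Exec B l (e.compile p) s t s' ∧ t ≤ e.cost ∧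
      s'.reg (2 * p) = e.eval s.vars (s.mem 0) l ∧ SameBelow p s s' := by
  induction e with
  | const z =>
    intro p s _ h hB
    have hz := (Ex.const z).abs_eval_le h
    exact ⟨1, _, .const _ _ _ (hz.trans (by exact_mod_cast hB)), le_rfl, by simp [eval],
      .setReg ..⟩
  | var i =>
    intro p s hp h hB
    have hz := (Ex.var i).abs_eval_le h
    have hi : (s.setReg (2 * p) 0).reg (2 * i) = s.reg (2 * i) :=
      (SameBelow.setReg p s 0).reg _ (by omega)
    have hv : ArithOp.add.eval ((s.setReg (2 * p) 0).reg (2 * i))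
        ((s.setReg (2 * p) 0).reg (2 * p)) = s.vars i := by
      simp [ArithOp.eval, hi, State.vars]
    refine ⟨2, _, .seq _ _ _ _ _ 1 1 (.const _ _ _ (by simp)) (.arith _ _ _ _ _ ?_), le_rfl, ?_, ?_⟩
    · rw [hv]; exact hz.trans (by exact_mod_cast hB)
    · rw [State.reg_setReg_self, hv, eval]
    · exact (SameBelow.setReg p s 0).trans (.setReg ..) le_rfl
  | op o a b iha ihb =>
    intro p s hp h hB
    have hM := h.two_le
    have hle : ∀ {m}, m ≤ (op o a b).deg → M ^ m ≤ B := fun hm =>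
      (Nat.pow_le_pow_right (by omega) hm).trans hB
    obtain ⟨t, s1, h1, ht, hv, hs⟩ := iha p s hp h (hle (by simp [deg]; omega))
    obtain ⟨t2, s2, h2, ht2, hv2, hs2⟩ := ihb (p + 1) s1 (by omega)
      (by rw [hs.vars hp, hs.mem]; exact h) (hle (by simp [deg]; omega))
    rw [hs.vars hp, hs.mem] at hv2
    have hz : o.eval (s2.reg (2 * p)) (s2.reg (2 * (p + 1)))
        = (op o a b).eval s.vars (s.mem 0) l := by
      rw [hv2, hs2.reg _ (by omega), hv, eval]
    refine ⟨_, _, .seq _ _ _ _ _ _ 1 (.seq _ _ _ _ _ _ _ h1 h2) (.arith _ _ _ _ _ ?_), ?_, ?_, ?_⟩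
    · rw [hz]; exact ((op o a b).abs_eval_le h).trans (by exact_mod_cast hB)
    · simp only [cost]; omega
    · rw [State.reg_setReg_self, hz]
    · exact (hs.trans hs2 (by omega)).trans (.setReg ..) le_rfl
  | inp a iha =>
    intro p s hp h hB
    have hM := h.two_le
    obtain ⟨t, s1, h1, ht, hv, hs⟩ := iha p s hp h
      ((Nat.pow_le_pow_right (by omega) (by simp [deg])).trans hB)
    have hz := (inp a).abs_eval_le h
    rcases lt_or_ge 0 (s1.reg (2 * p)) with h0 | h0
    · have hz' : l.getD (s1.reg (2 * p)).toNat 0 = (inp a).eval s.vars (s.mem 0) l := by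
        rw [eval, if_pos (by rwa [← hv]), hv]
      refine ⟨_, _, .seq _ _ _ _ _ _ _ h1 (.cond_pos _ _ _ _ _ _ h0 (.read _ _ _ h0.le ?_)),
        ?_, ?_, ?_⟩
      · rw [hz']; exact hz.trans (by exact_mod_cast hB)
      · simp only [cost]; omega
      · rw [State.reg_setReg_self, hz']
      · exact hs.trans (.setReg ..) le_rfl
    · refine ⟨_, _, .seq _ _ _ _ _ _ _ h1 (.cond_neg _ _ _ _ _ _ h0 (.const _ _ _ (by simp))),
        ?_, ?_, ?_⟩
      · simp only [cost]; omega
      · rw [State.reg_setReg_self, eval, if_neg (by rw [← hv]; omega)]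
      · exact hs.trans (.setReg ..) le_rfl
  | arr a iha =>
    intro p s hp h hB
    have hM := h.two_le
    obtain ⟨t, s1, h1, ht, hv, hs⟩ := iha p s hp h
      ((Nat.pow_le_pow_right (by omega) (by simp [deg])).trans hB)
    rcases lt_or_ge 0 (s1.reg (2 * p)) with h0 | h0
    · refine ⟨_, _, .seq _ _ _ _ _ _ _ h1 (.cond_pos _ _ _ _ _ _ h0 (.load _ _ _ _ h0.le)),
        ?_, ?_, ?_⟩
      · simp only [cost]; omega
      · rw [State.reg_setReg_self, eval, if_pos (by rwa [← hv]), hv, hs.mem]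
      · exact hs.trans (.setReg ..) le_rfl
    · refine ⟨_, _, .seq _ _ _ _ _ _ _ h1 (.cond_neg _ _ _ _ _ _ h0 (.const _ _ _ (by simp))),
        ?_, ?_, ?_⟩
      · simp only [cost]; omega
      · rw [State.reg_setReg_self, eval, if_neg (by rw [← hv]; omega)]
      · exact hs.trans (.setReg ..) le_rfl
  | ite c a b ihc iha ihb =>
    intro p s hp h hB
    have hM := h.two_le
    have hle : ∀ {m}, m ≤ (ite c a b).deg → M ^ m ≤ B := fun hm =>
      (Nat.pow_le_pow_right (by omega) hm).trans hB
    obtain ⟨t, s1, h1, ht, hv, hs⟩ := ihc p s hp h (hle (by simp [deg]; omega))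
    have h' : DataBound M l s1.vars (s1.mem 0) := by rw [hs.vars hp, hs.mem]; exact h
    rcases lt_or_ge 0 (s1.reg (2 * p)) with h0 | h0
    · obtain ⟨t2, s2, h2, ht2, hv2, hs2⟩ := iha p s1 hp h' (hle (by simp [deg]; omega))
      refine ⟨_, _, .seq _ _ _ _ _ _ _ h1 (.cond_pos _ _ _ _ _ _ h0 h2), ?_, ?_, ?_⟩
      · simp only [cost]; omega
      · rw [hv2, eval, if_pos (by rwa [← hv]), hs.vars hp, hs.mem]
      · exact hs.trans hs2 le_rfl
    · obtain ⟨t2, s2, h2, ht2, hv2, hs2⟩ := ihb p s1 hp h' (hle (by simp only [deg]; omega))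
      refine ⟨_, _, .seq _ _ _ _ _ _ _ h1 (.cond_neg _ _ _ _ _ _ h0 h2), ?_, ?_, ?_⟩
      · simp only [cost]; omega
      · rw [hv2, eval, if_neg (by rw [← hv]; omega), hs.vars hp, hs.mem]
      · exact hs.trans hs2 le_rfl

/-- `reg r := e` -/
def assign (r : ℕ) (e : Ex) : Cmd :=
  -- There is no copy instruction: the result in register 8 is moved by adding a zero held in
  -- register 10.
  .seq (e.compile 4) (.seq (.const 10 0) (.arith .add r 8 10))

theorem assign_exec {M B : ℕ} {l : List ℤ} (r : ℕ) (e : Ex) (s : State)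
    (h : DataBound M l s.vars (s.mem 0)) (hB : M ^ e.deg ≤ B) :
    ∃ t s', Exec B l (assign r e) s t s' ∧ t ≤ e.cost + 2 ∧
      s'.reg r = e.eval s.vars (s.mem 0) l ∧
      (∀ r', r' ≠ r → r' < 8 ∨ r' % 2 = 1 → s'.reg r' = s.reg r') ∧
      s'.mem = s.mem ∧ s'.out = s.out := by
  obtain ⟨t, s1, h1, ht, hv, hs⟩ := e.compile_exec (M := M) (B := B) 4 s le_rfl h hB
  have hz : ArithOp.add.eval ((s1.setReg 10 0).reg 8) ((s1.setReg 10 0).reg 10)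
      = e.eval s.vars (s.mem 0) l := by
    simp only [ArithOp.eval, State.reg_setReg]; simpa using hv
  refine ⟨_, _, .seq _ _ _ _ _ _ _ h1 (.seq _ _ _ _ _ 1 1 (.const _ _ _ (by simp))
    (.arith _ _ _ _ _ ?_)), by omega, ?_, ?_, hs.mem, hs.out⟩
  · rw [hz]; exact (e.abs_eval_le h).trans (by exact_mod_cast hB)
  · rw [State.reg_setReg_self, hz]
  · intro r' hr hr'
    rw [State.reg_setReg, if_neg hr, State.reg_setReg, if_neg (by omega), hs.reg _ (by omega)]

end RAM

namespace RAM

/-! ### Simulation of a program on a virtual input -/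

/-- All registers, array entries and output entries are at most `B`. -/
structure State.Bounded (B : ℕ) (s : State) : Prop where
  reg : ∀ r, |s.reg r| ≤ B
  mem : ∀ m i, |s.mem m i| ≤ B
  out : ∀ i, |s.out.getD i 0| ≤ B

theorem State.Bounded.init (B : ℕ) : State.init.Bounded B := by
  constructor <;> simp [State.init]

theorem State.Bounded.setReg {B : ℕ} {s : State} (h : s.Bounded B) (r : ℕ) {z : ℤ}
    (hz : |z| ≤ B) : (s.setReg r z).Bounded B where
  reg r' := by rw [State.reg_setReg]; split_ifs; exacts [hz, h.reg r']
  mem := h.mem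
  out := h.out

theorem State.mem_setMem (s : State) (m i m' i' : ℕ) (z : ℤ) :
    (s.setMem m i z).mem m' i' = if m' = m ∧ i' = i then z else s.mem m' i' := by
  unfold State.setMem
  by_cases hm : m' = m
  · subst hm
    simp [Function.update_apply]
  · simp [hm]

theorem getD_append_singleton (l : List ℤ) (z : ℤ) (i : ℕ) :
    (l ++ [z]).getD i 0 = if i = l.length then z else l.getD i 0 := by
  rcases lt_trichotomy i l.length with h | h | h
  · rw [List.getD_append _ _ _ _ h, if_neg h.ne]
  · subst h; simp
  · rw [if_neg h.ne', List.getD_eq_default _ _ (by simp; omega), List.getD_eq_default _ _ h.le]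

/-- Addresses and output entries of the simulated program become data of expressions, so they need
the bound that each instruction enforces on new values. -/
theorem Exec.bounded {B : ℕ} {l : List ℤ} {p : Cmd} {s s' : State} {t : ℕ}
    (h : Exec B l p s t s') (hs : s.Bounded B) : s'.Bounded B := by
  induction h with
  | const r z s h => exact hs.setReg r h
  | arith op r a b s h => exact hs.setReg r h
  | read r a s ha h => exact hs.setReg r h
  | load m r a s ha => exact hs.setReg r (hs.mem _ _)
  | store m a r s ha =>
    refine ⟨hs.reg, fun m' i' => ?_, hs.out⟩
    rw [State.mem_setMem]
    split_ifs
    exacts [hs.reg _, hs.mem _ _]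
  | emit r s =>
    refine ⟨hs.reg, hs.mem, fun i => ?_⟩
    simp only [getD_append_singleton]
    split_ifs
    exacts [hs.reg _, hs.out _]
  | seq p q s s' s'' t t' hp hq ihp ihq => exact ihq (ihp hs)
  | cond_pos r p q s s' t hr hp ih => exact ih hs
  | cond_neg r p q s s' t hr hp ih => exact ih hs
  | loop_done r p s hr => exact hs
  | loop_step r p s s' s'' t t' hr hp hl ihp ihl => exact ihl (ihp hs)

/-- Only `emit` lengthens the output, by one entry per step. This bounds the buffer pointer and,
later, the number of answer rows by the running time. -/
theorem Exec.length_out_le {B : ℕ} {l : List ℤ} {p : Cmd} {s s' : State} {t : ℕ}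
    (h : Exec B l p s t s') : s'.out.length ≤ s.out.length + t := by
  induction h with
  | emit r s => simp
  | seq p q s s' s'' t t' hp hq ihp ihq => omega
  | cond_pos r p q s s' t hr hp ih => omega
  | cond_neg r p q s s' t hr hp ih => omega
  | loop_step r p s s' s'' t t' hr hp hl ihp ihl => omega
  | _ => exact Nat.le_add_right _ _

/-- The program `sim e p` runs `p`, with register `r` in register `2 * r + 1` and array `m` in array
`m + 1`. The expression `e` computes the entry of the input of `p` whose position is in register
`2`. The output of `p` is stored in array `0`, from position `1` on, and its length in
register `4`. -/
def sim (e : Ex) : Cmd → Cmd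
  | .const r z => .const (2 * r + 1) z
  | .arith op r a b => .arith op (2 * r + 1) (2 * a + 1) (2 * b + 1)
  | .read r a => .seq (.seq (.const 2 0) (.arith .add 2 (2 * a + 1) 2)) (assign (2 * r + 1) e)
  | .load m r a => .load (m + 1) (2 * r + 1) (2 * a + 1)
  | .store m a r => .store (m + 1) (2 * a + 1) (2 * r + 1)
  | .emit r => .seq (assign 4 (.op .add (.var 2) (.const 1))) (.store 0 4 (2 * r + 1))
  | .seq p q => .seq (sim e p) (sim e q)
  | .cond r p q => .cond (2 * r + 1) (sim e p) (sim e q)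
  | .loop r p => .loop (2 * r + 1) (sim e p)

/-- The state `s'` of the simulation corresponds to the state `s`. -/
structure Simulates (M : ℕ) (N : ℤ) (s s' : State) : Prop where
  reg : ∀ r, s'.reg (2 * r + 1) = s.reg r
  mem : ∀ m i, s'.mem (m + 1) i = s.mem m i
  size : s'.reg 0 = N
  addr : |s'.reg 2| ≤ M
  len : s'.reg 4 = s.out.length
  best : s'.reg 6 = 0
  buf_zero : s'.mem 0 0 = 0
  buf : ∀ i, s'.mem 0 (i + 1) = s.out.getD i 0
  out : s'.out = []

theorem Simulates.dataBound {B M : ℕ} {N : ℤ} {l : List ℤ} {s s' : State}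
    (h : Simulates M N s s') (hs : s.Bounded B) (hM : 2 ≤ M) (hBM : B ≤ M) (hN : |N| ≤ M)
    (hl : ∀ i, |l.getD i 0| ≤ M) (hlen : s.out.length ≤ M) :
    DataBound M l s'.vars (s'.mem 0) where
  two_le := hM
  vars i := by
    fin_cases i
    · simpa [State.vars, h.size] using hN
    · simpa [State.vars] using h.addr
    · simpa [State.vars, h.len] using hlen
    · simp [State.vars, h.best]
  arr i := by
    cases i with
    | zero => simp [h.buf_zero]
    | succ i => rw [h.buf]; exact (hs.out i).trans (by exact_mod_cast hBM)
  inp := hl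

/-- The slowdown of a simulation. -/
def simFactor (e : Ex) : ℕ := e.cost + 10

/-- Every step is replaced by boundedly many; only `read` (evaluating `e`) and `emit` (writing to
the buffer) cost more than one instruction. The 3 in the exponent of `hB'` is the degree of the
expression that increments the output length, and `s.out.length + t ≤ M` keeps that length bounded
throughout. -/
theorem sim_exec {B M B' : ℕ} {N : ℤ} {inp inp' : List ℤ} {e : Ex} (hM : 2 ≤ M) (hBM : B ≤ M)
    (hN : |N| ≤ M) (hl : ∀ i, |inp'.getD i 0| ≤ M) (hB' : M ^ (e.deg + 3) ≤ B')
    (he : ∀ (ρ : Fin 4 → ℤ) (μ : ℕ → ℤ) (a : ℕ), ρ 0 = N → ρ 1 = a →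
      e.eval ρ μ inp' = inp.getD a 0)
    {p : Cmd} {s s₁ : State} {t : ℕ} (h : Exec B inp p s t s₁) :
    ∀ s' : State, Simulates M N s s' → s.Bounded B → s.out.length + t ≤ M →
      ∃ t' s₁', Exec B' inp' (sim e p) s' t' s₁' ∧ t' ≤ simFactor e * t ∧
        Simulates M N s₁ s₁' := by
  have hMB : M ≤ B' := by
    calc M = M ^ 1 := (pow_one M).symm
      _ ≤ M ^ (e.deg + 3) := Nat.pow_le_pow_right (by omega) (by omega)
      _ ≤ B' := hB'
  have hBB : (B : ℤ) ≤ B' := by exact_mod_cast hBM.trans hMB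
  have hset : ∀ {s s' : State} (r : ℕ) (z : ℤ), Simulates M N s s' →
      Simulates M N (s.setReg r z) (s'.setReg (2 * r + 1) z) := by
    intro s s' r z h
    have hne : ∀ q, q % 2 = 0 → (s'.setReg (2 * r + 1) z).reg q = s'.reg q := fun q hq => by
      rw [State.reg_setReg, if_neg (by omega)]
    refine ⟨fun r' => ?_, h.mem, ?_, ?_, ?_, ?_, h.buf_zero, h.buf, h.out⟩
    · simp only [State.reg_setReg, h.reg]
      congr 1
      simp
    · rw [hne _ rfl, h.size]
    · rw [hne _ rfl]; exact h.addr
    · rw [hne _ rfl]; exact h.len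
    · rw [hne _ rfl]; exact h.best
  have hK : ∀ t, t ≤ simFactor e * t := fun t => Nat.le_mul_of_pos_left _ (by simp [simFactor])
  induction h with
  | const r z s h =>
    intro s' hs _ _
    exact ⟨1, _, .const _ _ _ (h.trans hBB), hK 1, hset _ _ hs⟩
  | arith op r a b s h =>
    intro s' hs _ _
    refine ⟨1, _, .arith _ _ _ _ _ ?_, hK 1, ?_⟩
    · rw [hs.reg, hs.reg]; exact h.trans hBB
    · rw [hs.reg, hs.reg]; exact hset _ _ hs
  | read r a s ha h =>
    intro s' hs hb hlen
    have hv : ArithOp.add.eval ((s'.setReg 2 0).reg (2 * a + 1)) ((s'.setReg 2 0).reg 2)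
        = s.reg a := by
      simp [ArithOp.eval, State.reg_setReg, hs.reg]
    have hs2 : Simulates M N s ((s'.setReg 2 0).setReg 2 (s.reg a)) := by
      refine ⟨fun r' => ?_, hs.mem, ?_, ?_, ?_, ?_, hs.buf_zero, hs.buf, hs.out⟩
      · rw [State.reg_setReg, if_neg (by omega), State.reg_setReg, if_neg (by omega), hs.reg]
      · simpa [State.reg_setReg] using hs.size
      · simpa [State.reg_setReg] using (hb.reg a).trans (by exact_mod_cast hBM)
      · simpa [State.reg_setReg] using hs.len
      · simpa [State.reg_setReg] using hs.best
    obtain ⟨t, s₂, h₂, ht, hval, hreg, hmem, hout⟩ := assign_exec (B := B') (2 * r + 1) e _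
      (hs2.dataBound hb hM hBM hN hl (by omega))
      ((Nat.pow_le_pow_right (by omega) (by omega)).trans hB')
    have hval' : s₂.reg (2 * r + 1) = inp.getD (s.reg a).toNat 0 := by
      rw [hval]
      refine he _ _ _ ?_ ?_
      · simpa [State.vars] using hs2.size
      · simpa [State.vars] using ha
    refine ⟨_, s₂, .seq _ _ _ _ _ _ _ (.seq _ _ _ _ _ _ _ (.const _ _ _ (by simp))
      (.arith _ _ _ _ _ ?_)) (by rw [hv]; exact h₂), ?_, ?_⟩
    · rw [hv]; exact (hb.reg a).trans hBB
    · simp only [simFactor]; omega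
    · have h3 := hset r (inp.getD (s.reg a).toNat 0) hs2
      have hne : ∀ q, q < 8 → q % 2 = 0 → s₂.reg q = ((s'.setReg 2 0).setReg 2 (s.reg a)).reg q :=
        fun q hq hq' => hreg q (by omega) (.inl hq)
      refine ⟨fun r' => ?_, fun m i => ?_, ?_, ?_, ?_, ?_, ?_, fun i => ?_, ?_⟩
      · rw [State.reg_setReg]
        split_ifs with hr
        · rw [hr, hval']
        · rw [hreg _ (by omega) (by omega), hs2.reg]
      · rw [hmem]; exact hs2.mem m i
      · rw [hne _ (by omega) rfl]; exact hs2.size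
      · rw [hne _ (by omega) rfl]; exact hs2.addr
      · rw [hne _ (by omega) rfl]; exact hs2.len
      · rw [hne _ (by omega) rfl]; exact hs2.best
      · rw [hmem]; exact hs2.buf_zero
      · rw [hmem]; exact hs2.buf i
      · rw [hout]; exact hs2.out
  | load m r a s ha =>
    intro s' hs _ _
    refine ⟨1, _, .load _ _ _ _ (by rwa [hs.reg]), hK 1, ?_⟩
    rw [hs.reg, hs.mem]
    exact hset _ _ hs
  | store m a r s ha =>
    intro s' hs _ _
    refine ⟨1, _, .store _ _ _ _ (by rwa [hs.reg]), hK 1, ?_⟩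
    rw [hs.reg, hs.reg]
    refine ⟨hs.reg, fun m' i => ?_, hs.size, hs.addr, hs.len, hs.best, ?_, fun i => ?_, hs.out⟩
    · simp only [State.mem_setMem, hs.mem, Nat.add_right_cancel_iff]
    · rw [State.mem_setMem, if_neg (by omega), hs.buf_zero]
    · rw [State.mem_setMem, if_neg (by omega), hs.buf]; rfl
  | emit r s =>
    intro s' hs hb hlen
    obtain ⟨t, s₂, h₂, ht, hval, hreg, hmem, hout⟩ := assign_exec (B := B') 4
      (.op .add (.var 2) (.const 1)) _ (hs.dataBound hb hM hBM hN hl (by omega))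
      ((Nat.pow_le_pow_right (by omega) (by simp [Ex.deg])).trans hB')
    have hval' : s₂.reg 4 = s.out.length + 1 := by
      rw [hval]; simp [Ex.eval, ArithOp.eval, State.vars, hs.len]
    have hr : s₂.reg (2 * r + 1) = s.reg r := by rw [hreg _ (by omega) (by omega), hs.reg]
    refine ⟨_, _, .seq _ _ _ _ _ _ _ h₂ (.store 0 4 (2 * r + 1) _ (by rw [hval']; omega)), ?_, ?_⟩
    · simp only [simFactor]; simp [Ex.cost] at ht; omega
    -- The pointer is incremented before the store, so the buffer starts at position 1; expressions
    -- read the array only at positive positions.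
    · have hn : (s₂.reg 4).toNat = s.out.length + 1 := by omega
      rw [hn, hr]
      refine ⟨fun r' => ?_, fun m i => ?_, ?_, ?_, ?_, ?_, ?_, fun i => ?_, ?_⟩
      · exact (hreg _ (by omega) (by omega)).trans (hs.reg r')
      · rw [State.mem_setMem, if_neg (by omega), hmem, hs.mem]
      · exact (hreg _ (by omega) (by omega)).trans hs.size
      · change |s₂.reg 2| ≤ M
        rw [hreg _ (by omega) (by omega)]; exact hs.addr
      · change s₂.reg 4 = _
        rw [hval']; simp
      · exact (hreg _ (by omega) (by omega)).trans hs.best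
      · rw [State.mem_setMem, if_neg (by omega), hmem, hs.buf_zero]
      · simp only [State.mem_setMem, getD_append_singleton, hmem, hs.buf]
        simp
      · exact hout.trans hs.out
  | seq p q s s₁ s₂ t t' hp hq ihp ihq =>
    intro s' hs hb hlen
    obtain ⟨t1, s1, h1, ht1, hs1⟩ := ihp s' hs hb (by omega)
    have := hp.length_out_le
    obtain ⟨t2, s2, h2, ht2, hs2⟩ := ihq s1 hs1 (hp.bounded hb) (by omega)
    exact ⟨_, _, .seq _ _ _ _ _ _ _ h1 h2, by rw [mul_add]; omega, hs2⟩
  | cond_pos r p q s s₁ t hr hp ih =>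
    intro s' hs hb hlen
    obtain ⟨t1, s1, h1, ht1, hs1⟩ := ih s' hs hb (by omega)
    exact ⟨_, _, .cond_pos _ _ _ _ _ _ (by rwa [hs.reg]) h1,
      by rw [mul_add]; have := hK 1; omega, hs1⟩
  | cond_neg r p q s s₁ t hr hp ih =>
    intro s' hs hb hlen
    obtain ⟨t1, s1, h1, ht1, hs1⟩ := ih s' hs hb (by omega)
    exact ⟨_, _, .cond_neg _ _ _ _ _ _ (by rwa [hs.reg]) h1,
      by rw [mul_add]; have := hK 1; omega, hs1⟩
  | loop_done r p s hr =>
    intro s' hs _ _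
    exact ⟨1, _, .loop_done _ _ _ (by rwa [hs.reg]), hK 1, hs⟩
  | loop_step r p s s₁ s₂ t t' hr hp hl ihp ihl =>
    intro s' hs hb hlen
    obtain ⟨t1, s1, h1, ht1, hs1⟩ := ihp s' hs hb (by omega)
    have := hp.length_out_le
    obtain ⟨t2, s2, h2, ht2, hs2⟩ := ihl s1 hs1 (hp.bounded hb) (by omega)
    exact ⟨_, _, .loop_step _ _ _ _ _ _ _ (by rwa [hs.reg]) h1 h2,
      by rw [mul_add, mul_add]; have := hK 1; omega, hs2⟩

end RAM

namespace RAM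

/-! ### Minimizing over the rows of the simulated output -/

/-- One step of the minimization: the row that ends at the position in register `4` is taken into
account in register `6`, and then removed. -/
def minStep (W : ℕ) (sc : Ex) : Cmd :=
  .seq (assign 6 (.ite (.op .sub (.var 3) sc) sc (.var 3)))
    (assign 4 (.op .sub (.var 2) (.const W)))

def minStepCost (W : ℕ) (sc : Ex) : ℕ :=
  (Ex.ite (.op .sub (.var 3) sc) sc (.var 3)).cost + (Ex.op .sub (.var 2) (.const W)).cost + 5

def minStepDeg (W : ℕ) (sc : Ex) : ℕ :=
  (Ex.ite (.op .sub (.var 3) sc) sc (.var 3)).deg + (Ex.op .sub (.var 2) (.const W)).deg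

/-- Rows are consumed from the last to the first, so register 4 is both the row pointer and the loop
counter. The scores `S i` need no upper bound by `M`: register 6 only decreases, and it stays
nonnegative because `0 ≤ S i`. -/
theorem minLoop_exec {M B W : ℕ} {N : ℤ} {l : List ℤ} {sc : Ex} {μ : ℕ → ℤ} {S : ℕ → ℤ}
    (hW : 0 < W) (hM : 2 ≤ M) (hN : |N| ≤ M) (hl : ∀ i, |l.getD i 0| ≤ M) (hμ : ∀ i, |μ i| ≤ M)
    (hB : M ^ minStepDeg W sc ≤ B) (j : ℕ)
    (hS : ∀ i < j, 0 ≤ S i ∧ ∀ ρ : Fin 4 → ℤ, ρ 0 = N → ρ 2 = ((i + 1) * W : ℕ) →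
      sc.eval ρ μ l = S i) (hj : j * W ≤ M) :
    ∀ s : State, s.reg 0 = N → |s.reg 2| ≤ M → s.reg 4 = (j * W : ℕ) → 0 ≤ s.reg 6 →
      s.reg 6 ≤ M → (∀ i, s.mem 0 i = μ i) →
    ∃ t s', Exec B l (.loop 4 (minStep W sc)) s t s' ∧ t ≤ minStepCost W sc * j + 1 ∧
      s'.reg 0 = N ∧ |s'.reg 2| ≤ M ∧ s'.reg 4 = 0 ∧ s'.mem = s.mem ∧ s'.out = s.out ∧
      0 ≤ s'.reg 6 ∧ s'.reg 6 ≤ s.reg 6 ∧ (∀ i < j, s'.reg 6 ≤ S i) ∧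
      (s'.reg 6 = s.reg 6 ∨ ∃ i < j, s'.reg 6 = S i) := by
  have hle : ∀ {m}, m ≤ minStepDeg W sc → M ^ m ≤ B := fun hm =>
    (Nat.pow_le_pow_right (by omega) hm).trans hB
  induction j with
  | zero =>
    intro s h0 h2 h4 h6 h6' hm
    have h4' : s.reg 4 = 0 := by simpa using h4
    exact ⟨1, s, .loop_done _ _ _ h4'.le, by omega, h0, h2, h4', rfl, rfl, h6, le_rfl,
      by omega, .inl rfl⟩
  | succ j ih =>
    intro s h0 h2 h4 h6 h6' hm
    have hbd : DataBound M l s.vars (s.mem 0) := by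
      refine ⟨hM, fun i => ?_, fun i => by rw [hm]; exact hμ i, hl⟩
      fin_cases i
      · simpa [State.vars, h0] using hN
      · simpa [State.vars] using h2
      · change |s.reg 4| ≤ _
        rw [h4, abs_of_nonneg (by positivity)]
        exact_mod_cast hj
      · simpa [State.vars, abs_of_nonneg h6] using h6'
    obtain ⟨t1, s1, e1, ht1, hv1, hr1, hm1, ho1⟩ := assign_exec (B := B) 6
      (.ite (.op .sub (.var 3) sc) sc (.var 3)) s hbd (hle (by simp [minStepDeg]))
    have hμ' : s.mem 0 = μ := funext hm
    have hsc : sc.eval s.vars (s.mem 0) l = S j := by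
      rw [hμ']
      exact (hS j (by omega)).2 _ (by simpa [State.vars] using h0)
        (by simpa [State.vars] using h4)
    have hSj := (hS j (by omega)).1
    have hv1' : s1.reg 6 = min (s.reg 6) (S j) := by
      rw [hv1]
      simp only [Ex.eval, hsc, ArithOp.eval, show s.vars 3 = s.reg 6 from rfl, min_def]
      split_ifs <;> omega
    have hbd1 : DataBound M l s1.vars (s1.mem 0) := by
      refine ⟨hM, fun i => ?_, fun i => by rw [hm1, hm]; exact hμ i, hl⟩
      by_cases hi : i = 3
      · subst hi
        simp only [State.vars]
        change |s1.reg 6| ≤ _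
        rw [hv1', abs_of_nonneg (le_min h6 hSj)]
        exact (min_le_left _ _).trans h6'
      · have hi' : (i : ℕ) ≠ 3 := fun h => hi (Fin.ext h)
        have := hbd.vars i
        simp only [State.vars] at this ⊢
        rwa [hr1 _ (by omega) (by omega)]
    obtain ⟨t2, s2, e2, ht2, hv2, hr2, hm2, ho2⟩ := assign_exec (B := B) 4
      (.op .sub (.var 2) (.const W)) s1 hbd1 (hle (by simp [minStepDeg]))
    have hv2' : s2.reg 4 = (j * W : ℕ) := by
      rw [hv2]
      simp only [Ex.eval, ArithOp.eval, State.vars]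
      change s1.reg 4 - _ = _
      rw [hr1 _ (by omega) (by omega), h4]
      push_cast
      ring
    have h26 : s2.reg 6 = min (s.reg 6) (S j) := by rw [hr2 _ (by omega) (by omega), hv1']
    have h20 : s2.reg 0 = N := by
      rw [hr2 _ (by omega) (by omega), hr1 _ (by omega) (by omega), h0]
    have h22 : |s2.reg 2| ≤ M := by
      rw [hr2 _ (by omega) (by omega), hr1 _ (by omega) (by omega)]; exact h2
    obtain ⟨t3, s3, e3, ht3, a0, a2, a4, am, ao, a6, a6', aS, aE⟩ :=
      ih (fun i hi => hS i (by omega)) ((Nat.mul_le_mul_right _ (by omega)).trans hj) s2 h20 h22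
        hv2' (by rw [h26]; exact le_min h6 hSj) (by rw [h26]; exact (min_le_left _ _).trans h6')
        (fun i => by rw [hm2, hm1, hm])
    have hpos : 0 < s.reg 4 := by rw [h4]; exact_mod_cast Nat.mul_pos (by omega) hW
    refine ⟨_, s3, .loop_step _ _ _ _ _ _ _ hpos (.seq _ _ _ _ _ _ _ e1 e2) e3, ?_, a0, a2, a4,
      by rw [am, hm2, hm1], by rw [ao, ho2, ho1], a6, ?_, ?_, ?_⟩
    · have : minStepCost W sc * (j + 1) = minStepCost W sc * j + minStepCost W sc := by ring
      have : t1 + t2 + 1 ≤ minStepCost W sc := by simp only [minStepCost]; omega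
      omega
    · exact a6'.trans (h26.le.trans (min_le_left _ _))
    · intro i hi
      rcases Nat.lt_succ_iff_lt_or_eq.mp hi with h | rfl
      · exact aS i h
      · exact a6'.trans (h26.le.trans (min_le_right _ _))
    · rcases aE with h | ⟨i, hi, h⟩
      · rw [h26] at h
        rcases min_choice (s.reg 6) (S j) with h' | h'
        · exact .inl (h.trans h')
        · exact .inr ⟨j, by omega, h.trans h'⟩
      · exact .inr ⟨i, by omega, h⟩

/-- The minimum (capped by `big`) of `sc` over the rows of the output of the simulation of `p` is
computed, and, if it is less than `big`, emitted after subtraction of `shift`. Nothing is done if the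
first entry of the input is not positive. -/
def minProgram (W : ℕ) (e sc big shift : Ex) (p : Cmd) : Cmd :=
  .seq (.seq (.const 0 0) (.read 0 0)) (.cond 0
    (.seq (.seq (.seq (sim e p) (assign 6 big)) (.loop 4 (minStep W sc)))
      (.seq (assign 2 (.op .sub big (.var 3)))
        (.cond 2 (.seq (assign 2 (.op .sub (.var 3) shift)) (.emit 2)) (.const 2 0))))
    (.const 0 0))

def minProgramDeg (W : ℕ) (e sc big shift : Ex) : ℕ :=
  e.deg + minStepDeg W sc + big.deg + shift.deg + 3

def minProgramFactor (W : ℕ) (e sc big shift : Ex) : ℕ :=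
  simFactor e + minStepCost W sc + 2 * big.cost + shift.cost + 30

/-- This branch serves the graph without vertices, for which base-`N` encodings make no sense. -/
theorem minProgram_exec_of_nonpos {B W : ℕ} {l : List ℤ} {e sc big shift : Ex} {p : Cmd}
    (h0 : l.getD 0 0 ≤ 0) (hB : |l.getD 0 0| ≤ B) :
    ∃ t s, Exec B l (minProgram W e sc big shift p) .init t s ∧ t ≤ 4 ∧ s.out = [] := by
  refine ⟨_, _, .seq _ _ _ _ _ _ _ (.seq _ _ _ _ _ _ _ (.const _ _ _ (by simp))
    (.read 0 0 _ (by simp) (by simpa using hB))) (.cond_neg _ _ _ _ _ _ (by simpa using h0)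
      (.const _ _ _ (by simp))), by omega, rfl⟩

theorem minProgram_exec {B M B' W m : ℕ} {N Big Shift : ℤ} {inp inp' : List ℤ}
    {e sc big shift : Ex} {S : ℕ → ℤ} {p : Cmd} {s₁ : State} {t : ℕ}
    (h : Exec B inp p .init t s₁)
    (hW : 0 < W) (hM : 2 ≤ M) (hBM : B ≤ M) (hN : 0 < N) (hl : ∀ i, |inp'.getD i 0| ≤ M)
    (hB' : M ^ minProgramDeg W e sc big shift ≤ B') (htM : t ≤ M) (hl0 : inp'.getD 0 0 = N)
    (he : ∀ (ρ : Fin 4 → ℤ) (μ : ℕ → ℤ) (a : ℕ), ρ 0 = N → ρ 1 = a →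
      e.eval ρ μ inp' = inp.getD a 0)
    (hlen : s₁.out.length = m * W)
    (hS : ∀ i < m, 0 ≤ S i ∧ ∀ (ρ : Fin 4 → ℤ) (μ : ℕ → ℤ), ρ 0 = N → ρ 2 = ((i + 1) * W : ℕ) →
      (∀ a, μ (a + 1) = s₁.out.getD a 0) → sc.eval ρ μ inp' = S i)
    (hbig : ∀ (ρ : Fin 4 → ℤ) (μ : ℕ → ℤ), ρ 0 = N → big.eval ρ μ inp' = Big)
    (hshift : ∀ (ρ : Fin 4 → ℤ) (μ : ℕ → ℤ), ρ 0 = N → shift.eval ρ μ inp' = Shift)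
    (hBig : 0 ≤ Big) (hBig' : Big ≤ M) :
    ∃ (t' : ℕ) (s' : State) (b : ℤ), Exec B' inp' (minProgram W e sc big shift p) .init t' s' ∧
      t' ≤ minProgramFactor W e sc big shift * (t + 1) ∧
      s'.out = (if b < Big then [b - Shift] else []) ∧
      b ≤ Big ∧ (∀ i < m, b ≤ S i) ∧ (b = Big ∨ ∃ i < m, b = S i) := by
  have hle : ∀ {d}, d ≤ minProgramDeg W e sc big shift → M ^ d ≤ B' := fun hd =>
    (Nat.pow_le_pow_right (by omega) hd).trans hB'
  have hMB : (M : ℤ) ≤ B' := by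
    exact_mod_cast (pow_one M).symm.le.trans (hle (d := 1) (by simp only [minProgramDeg]; omega))
  have hN' : |N| ≤ M := hl0 ▸ hl 0
  set s0 := ((State.init.setReg 0 0).setReg 0 N) with hs0
  have e0 : Exec B' inp' (.seq (.const 0 0) (.read 0 0)) .init 2 s0 := by
    have := Exec.read (B := B') (inp := inp') 0 0 (State.init.setReg 0 0) (by simp)
      (by rw [State.reg_setReg_self, Int.toNat_zero, hl0]; exact hN'.trans hMB)
    simp only [State.reg_setReg_self, Int.toNat_zero, hl0] at this
    exact .seq _ _ _ _ _ 1 1 (.const _ _ _ (by simp)) this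
  have hsim0 : Simulates M N .init s0 := by
    constructor <;> simp [hs0, State.setReg, State.init]
  have hlt := h.length_out_le
  simp only [State.init, List.length_nil, zero_add] at hlt
  obtain ⟨t1, s1, e1, ht1, hs1⟩ := sim_exec (B' := B') hM hBM hN' hl
    (hle (by simp [minProgramDeg]; omega)) he h s0 hsim0 (.init B)
    (by simp [State.init]; exact htM)
  have hbd1 := hs1.dataBound (h.bounded (.init B)) hM hBM hN' hl (by omega)
  obtain ⟨t2, s2, e2, ht2, hv2, hr2, hm2, ho2⟩ := assign_exec (B := B') 6 big s1 hbd1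
    (hle (by simp [minProgramDeg]; omega))
  rw [hbig _ _ hs1.size] at hv2
  obtain ⟨t3, s3, e3, ht3, a0, a2, a4, am, ao, a6, a6', aS, aE⟩ := minLoop_exec (B := B') (S := S)
    (sc := sc) (μ := s1.mem 0) hW hM hN' hl hbd1.arr (hle (by simp [minProgramDeg]; omega)) m
    (fun i hi => ⟨(hS i hi).1, fun ρ h0 h2 => (hS i hi).2 ρ _ h0 h2 hs1.buf⟩) (by omega) s2
    (by rw [hr2 _ (by omega) (by omega), hs1.size])
    (by rw [hr2 _ (by omega) (by omega)]; exact hs1.addr)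
    (by rw [hr2 _ (by omega) (by omega), hs1.len, hlen]) (by rw [hv2]; exact hBig)
    (by rw [hv2]; exact hBig') (by intro i; rw [hm2])
  rw [hv2] at a6' aE
  have hbd3 : DataBound M inp' s3.vars (s3.mem 0) := by
    refine ⟨hM, fun i => ?_, fun i => by rw [am, hm2]; exact hbd1.arr i, hl⟩
    fin_cases i
    · simpa [State.vars, a0] using hN'
    · simpa [State.vars] using a2
    · simp [State.vars, a4]
    · simpa [State.vars, abs_of_nonneg a6] using a6'.trans hBig'
  obtain ⟨t4, s4, e4, ht4, hv4, hr4, hm4, ho4⟩ := assign_exec (B := B') 2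
    (.op .sub big (.var 3)) s3 hbd3 (hle (by simp [minProgramDeg, minStepDeg, Ex.deg]; omega))
  have hv4' : s4.reg 2 = Big - s3.reg 6 := by
    rw [hv4]
    simp only [Ex.eval, ArithOp.eval]
    rw [hbig _ _ (by exact a0)]
    rfl
  have hout4 : s4.out = [] := by rw [ho4, ao, ho2, hs1.out]
  -- Each row has `W > 0` entries and each entry took a step, so the scan costs no more than a
  -- constant times the simulated run.
  have hmt : m ≤ t := (Nat.le_mul_of_pos_right m hW).trans (by omega)
  have hcost : minStepCost W sc * m ≤ minStepCost W sc * t := Nat.mul_le_mul_left _ hmt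
  have hF : minProgramFactor W e sc big shift * (t + 1) = simFactor e * t + minStepCost W sc * t +
      (2 * big.cost + shift.cost + 30) * t + (simFactor e + minStepCost W sc + 2 * big.cost +
      shift.cost + 30) := by simp only [minProgramFactor]; ring
  have hpos : 0 < s0.reg 0 := by simpa [hs0] using hN
  simp only [Ex.cost] at ht4
  by_cases hb : s3.reg 6 < Big
  · have hbd4 : DataBound M inp' s4.vars (s4.mem 0) := by
      refine ⟨hM, fun i => ?_, fun i => by rw [hm4]; exact hbd3.arr i, hl⟩
      by_cases hi : i = 1
      · subst hi
        change |s4.reg 2| ≤ _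
        rw [hv4', abs_of_nonneg (by omega)]
        omega
      · have hi' : (i : ℕ) ≠ 1 := fun h => hi (Fin.ext h)
        have := hbd3.vars i
        simp only [State.vars] at this ⊢
        rwa [hr4 _ (by omega) (by omega)]
    obtain ⟨t5, s5, e5, ht5, hv5, hr5, hm5, ho5⟩ := assign_exec (B := B') 2
      (.op .sub (.var 3) shift) s4 hbd4 (hle (by simp [minProgramDeg, minStepDeg, Ex.deg]; omega))
    have hv5' : s5.reg 2 = s3.reg 6 - Shift := by
      rw [hv5]
      simp only [Ex.eval, ArithOp.eval]
      rw [hshift _ _ (show s4.reg 0 = N by rw [hr4 _ (by omega) (by omega), a0])]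
      change s4.reg 6 - _ = _
      rw [hr4 _ (by omega) (by omega)]
    simp only [Ex.cost] at ht5
    refine ⟨_, _, s3.reg 6, .seq _ _ _ _ _ _ _ e0 (.cond_pos _ _ _ _ _ _ hpos
      (.seq _ _ _ _ _ _ _ (.seq _ _ _ _ _ _ _ (.seq _ _ _ _ _ _ _ e1 e2) e3)
      (.seq _ _ _ _ _ _ _ e4 (.cond_pos _ _ _ _ _ _ (by omega)
      (.seq _ _ _ _ _ _ _ e5 (.emit 2 _)))))), ?_, ?_, a6', aS, aE⟩
    · omega
    · simp [hb, ho5, hout4, hv5']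
  · refine ⟨_, _, s3.reg 6, .seq _ _ _ _ _ _ _ e0 (.cond_pos _ _ _ _ _ _ hpos
      (.seq _ _ _ _ _ _ _ (.seq _ _ _ _ _ _ _ (.seq _ _ _ _ _ _ _ e1 e2) e3)
      (.seq _ _ _ _ _ _ _ e4 (.cond_neg _ _ _ _ _ _ (by omega)
      (.const _ _ _ (by simp)))))), ?_, ?_, a6', aS, aE⟩
    · omega
    · simp only [hb, if_false]; exact hout4

end RAM

/-! ### Tropical sums and listings -/

theorem trop_finsum_mem_le {α : Type*} {f : α → Trop} (hf : f.support.Finite) {s : Set α} {z : α}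
    (hz : z ∈ s) : Tropical.untrop (∑ᶠ z ∈ s, f z) ≤ Tropical.untrop (f z) := by
  classical
  have hfin : (s ∩ f.support).Finite := hf.subset Set.inter_subset_right
  rw [finsum_mem_eq_sum f hfin, Finset.untrop_sum']
  by_cases h0 : f z = 0
  · rw [h0]; exact le_top
  · exact Finset.inf_le (f := Tropical.untrop ∘ f) (by simpa using ⟨hz, h0⟩)

/-- A tropical sum is an infimum; being finite and, as the value is not `∞`, over a nonempty set, it
is attained. -/
theorem exists_trop_finsum_mem_eq {α : Type*} {f : α → Trop} (hf : f.support.Finite) {s : Set α}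
    (h : ∑ᶠ z ∈ s, f z ≠ 0) : ∃ z ∈ s, ∑ᶠ z ∈ s, f z = f z := by
  classical
  have hfin : (s ∩ f.support).Finite := hf.subset Set.inter_subset_right
  rw [finsum_mem_eq_sum f hfin] at h ⊢
  have hne : hfin.toFinset.Nonempty := by
    by_contra hne
    rw [Finset.not_nonempty_iff_eq_empty] at hne
    simp [hne] at h
  obtain ⟨z, hz, he⟩ := Finset.exists_mem_eq_inf _ hne (Tropical.untrop ∘ f)
  refine ⟨z, (by simpa using hz : z ∈ s ∧ _).1, Tropical.untrop_injective ?_⟩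
  rw [Finset.untrop_sum', he]
  rfl

theorem FAQ.untrop_eval_le {n : ℕ} (φ : FAQ n) (D : φ.Database Trop) (z : Fin n → ℕ) :
    Tropical.untrop (φ.eval D (φ.head.restrict z)) ≤
      Tropical.untrop (∏ J : φ.edges, D J (J.1.restrict z)) :=
  trop_finsum_mem_le (f := fun v : Fin n → ℕ => ∏ J : φ.edges, D J (J.1.restrict v))
    (s := {v | φ.head.restrict v = φ.head.restrict z}) (φ.finite_valuations D) rfl

theorem FAQ.exists_eval_eq {n : ℕ} (φ : FAQ n) (D : φ.Database Trop) {t : φ.head → ℕ}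
    (h : φ.eval D t ≠ 0) : ∃ z : Fin n → ℕ, φ.head.restrict z = t ∧
      φ.eval D t = ∏ J : φ.edges, D J (J.1.restrict z) :=
  exists_trop_finsum_mem_eq (f := fun v : Fin n → ℕ => ∏ J : φ.edges, D J (J.1.restrict v))
    (φ.finite_valuations D) h

theorem trop_natCast_ne_zero (m : ℕ) : Tropical.trop (m : ℝ≥0∞) ≠ 0 := by
  intro h
  have := congrArg Tropical.untrop h
  simp at this

theorem prod_trop_natCast {ι : Type*} (s : Finset ι) (m : ι → ℕ) :
    ∏ i ∈ s, Tropical.trop (m i : ℝ≥0∞) = Tropical.trop ((∑ i ∈ s, m i : ℕ) : ℝ≥0∞) := by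
  rw [← trop_sum, Nat.cast_sum]

/-- The relation with a given listing. -/
noncomputable def relationOfList {n : ℕ} {J : Finset (Fin n)} (L : List ((J → ℕ) × ℕ)) :
    SRelation Trop J :=
  (L.map fun p => Finsupp.single p.1 (Tropical.trop (p.2 : ℝ≥0∞))).sum

/-- Distinctness of the tuples matters because at a repeated tuple the sum would take the minimum of
the annotations. -/
theorem isListing_relationOfList {n : ℕ} {J : Finset (Fin n)} (L : List ((J → ℕ) × ℕ))
    (hL : (L.map Prod.fst).Nodup) : IsListing L (relationOfList L) := by
  refine ⟨hL, ?_⟩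
  induction L with
  | nil => simp [relationOfList]
  | cons p L ih =>
    rw [List.map_cons, List.nodup_cons] at hL
    obtain ⟨ih1, ih2⟩ := ih hL.2
    have hp : relationOfList L p.1 = 0 := by
      by_contra h
      exact hL.1 ((ih1 _).2 h)
    have hcons : ∀ t, relationOfList (p :: L) t
        = if p.1 = t then Tropical.trop (p.2 : ℝ≥0∞) else relationOfList L t := by
      intro t
      rw [show relationOfList (p :: L) = Finsupp.single p.1 (Tropical.trop (p.2 : ℝ≥0∞)) +
        relationOfList L by simp [relationOfList], Finsupp.add_apply, Finsupp.single_apply]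
      split_ifs with h
      · subst h; rw [hp, add_zero]
      · rw [zero_add]
    constructor
    · intro t
      rw [hcons, List.map_cons, List.mem_cons, ih1]
      split_ifs with h
      · simp [h, trop_natCast_ne_zero]
      · simp [show t ≠ p.1 from fun h' => h h'.symm]
    · intro q hq
      rw [hcons]
      rcases List.mem_cons.1 hq with rfl | hq
      · simp
      · rw [if_neg, ih2 q hq]
        rintro h
        exact hL.1 (h ▸ List.mem_map_of_mem hq)

/-! ### Databases from weighted graphs -/

section Encoding

variable {n k : ℕ} (ψ : Fin k → Finset (Fin n)) (N : ℕ)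

/-- The constant for variable `i` that encodes the vertices `a v` for all `v` with `i ∈ ψ v`. -/
def code (a : Fin k → ℕ) (i : Fin n) : ℕ := ∑ v, if i ∈ ψ v then a v * N ^ (v : ℕ) else 0

variable {N} in
-- Positions `v` with `i ∉ ψ v` get digit 0. The size bound and the extraction of digits then come
-- from the bijection of digit sequences with numbers.
theorem code_eq_finFunctionFinEquiv {a : Fin k → ℕ} (ha : ∀ v, a v < N) (i : Fin n) :
    code ψ N a i = finFunctionFinEquiv (fun v => if i ∈ ψ v then (⟨a v, ha v⟩ : Fin N) else
      ⟨0, (Nat.zero_le _).trans_lt (ha v)⟩) := by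
  rw [finFunctionFinEquiv_apply, code]
  refine Finset.sum_congr rfl fun v _ => ?_
  split_ifs <;> simp

variable {N} in
theorem code_lt {a : Fin k → ℕ} (ha : ∀ v, a v < N) (i : Fin n) : code ψ N a i < N ^ k := by
  rw [code_eq_finFunctionFinEquiv ψ ha]
  exact Fin.is_lt _

/-- The digit of `x` at position `v` in base `N`. -/
def digit (x : ℕ) (v : Fin k) : ℕ := x / N ^ (v : ℕ) % N

variable {N} in
theorem digit_code {a : Fin k → ℕ} (ha : ∀ v, a v < N) {i : Fin n} {v : Fin k} (hi : i ∈ ψ v) :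
    digit N (code ψ N a i) v = a v := by
  rw [code_eq_finFunctionFinEquiv ψ ha, digit, ← finFunctionFinEquiv_symm_apply_val,
    Equiv.symm_apply_apply, if_pos hi]

/-- The vertices of the clique that meet `J`. -/
def meeting (J : Finset (Fin n)) : Finset (Fin k) := Finset.univ.filter fun v => (ψ v ∩ J).Nonempty

variable {ψ} in
theorem mem_meeting {J : Finset (Fin n)} {v : Fin k} : v ∈ meeting ψ J ↔ (ψ v ∩ J).Nonempty := by
  simp [meeting]

/-- The position of `v` among the vertices that meet `J`. -/
noncomputable def meetingRank (J : Finset (Fin n)) (v : Fin k) : ℕ :=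
  if h : v ∈ meeting ψ J then (meeting ψ J).equivFin ⟨v, h⟩ else 0

open Classical in
/-- The vertices of row `r` of the relation for `J`. -/
noncomputable def rowDigit (J : Finset (Fin n)) (r : ℕ) (v : Fin k) : ℕ :=
  if v ∈ meeting ψ J then r / N ^ meetingRank ψ J v % N else 0

variable {N} in
theorem rowDigit_lt (hN : 0 < N) (J : Finset (Fin n)) (r : ℕ) (v : Fin k) :
    rowDigit ψ N J r v < N := by
  unfold rowDigit
  split_ifs
  exacts [Nat.mod_lt _ hN, hN]

theorem rowDigit_eq {J : Finset (Fin n)} (r : Fin (N ^ weakEdgeDepth ψ J)) {v : Fin k}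
    (h : v ∈ meeting ψ J) :
    rowDigit ψ N J r v = (finFunctionFinEquiv.symm r ((meeting ψ J).equivFin ⟨v, h⟩) : ℕ) := by
  rw [rowDigit, if_pos h, meetingRank, dif_pos h]
  exact (finFunctionFinEquiv_symm_apply_val r _).symm

/-- A row number has one base-`N` digit per member of `meeting ψ J`. With `exists_rowDigit_eq`, rows
correspond exactly to assignments on `meeting ψ J`. -/
theorem rowDigit_injOn {J : Finset (Fin n)} {r r' : ℕ} (hr : r < N ^ weakEdgeDepth ψ J)
    (hr' : r' < N ^ weakEdgeDepth ψ J)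
    (h : ∀ v ∈ meeting ψ J, rowDigit ψ N J r v = rowDigit ψ N J r' v) : r = r' := by
  have : (⟨r, hr⟩ : Fin _) = ⟨r', hr'⟩ := by
    refine finFunctionFinEquiv.symm.injective (funext fun j => Fin.ext ?_)
    obtain ⟨⟨v, hv⟩, rfl⟩ := (meeting ψ J).equivFin.surjective j
    rw [← rowDigit_eq ψ N ⟨r, hr⟩ hv, ← rowDigit_eq ψ N ⟨r', hr'⟩ hv]
    exact h v hv
  exact congrArg Fin.val this

variable {N} in
theorem exists_rowDigit_eq {a : Fin k → ℕ} (ha : ∀ v, a v < N) (J : Finset (Fin n)) :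
    ∃ r < N ^ weakEdgeDepth ψ J, ∀ v ∈ meeting ψ J, rowDigit ψ N J r v = a v := by
  let r : Fin (N ^ weakEdgeDepth ψ J) := finFunctionFinEquiv fun j =>
    (⟨a ((meeting ψ J).equivFin.symm j), ha _⟩ : Fin N)
  refine ⟨r, r.2, fun v hv => ?_⟩
  rw [rowDigit_eq ψ N r hv, Equiv.symm_apply_apply]
  simp

theorem code_congr {J : Finset (Fin n)} {a b : Fin k → ℕ} (h : ∀ v ∈ meeting ψ J, a v = b v)
    {i : Fin n} (hi : i ∈ J) : code ψ N a i = code ψ N b i := by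
  refine Finset.sum_congr rfl fun v _ => ?_
  split_ifs with hv
  · rw [h v (mem_meeting.2 ⟨i, Finset.mem_inter.2 ⟨hv, hi⟩⟩)]
  · rfl

/-- The tuple in row `r` of the relation for `J`. -/
noncomputable def rowTuple (J : Finset (Fin n)) (r : ℕ) : J → ℕ :=
  fun i => code ψ N (rowDigit ψ N J r) i

/-- Each `v` that meets `J` shows its digit in some variable `i ∈ ψ v ∩ J`, so the tuple determines
all digits of the row number. -/
theorem rowTuple_injOn (hN : 0 < N) {J : Finset (Fin n)} {r r' : ℕ}
    (hr : r < N ^ weakEdgeDepth ψ J) (hr' : r' < N ^ weakEdgeDepth ψ J)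
    (h : rowTuple ψ N J r = rowTuple ψ N J r') : r = r' := by
  refine rowDigit_injOn ψ N hr hr' fun v hv => ?_
  obtain ⟨i, hi⟩ := mem_meeting.1 hv
  rw [Finset.mem_inter] at hi
  have := congrFun h ⟨i, hi.2⟩
  simp only [rowTuple] at this
  rw [← digit_code ψ (rowDigit_lt ψ hN J r) hi.1, this,
    digit_code ψ (rowDigit_lt ψ hN J r') hi.1]

end Encoding

/-! ### The database of a weighted graph -/

section Database

variable {n k : ℕ} (φ : FAQ n) (ψ : Fin k → Finset (Fin n)) (N : ℕ) (wt : ℕ → ℕ → ℕ)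

open Classical in
/-- Some hyperedge of the query that meets both members of a pair, if there is one. -/
noncomputable def pairEdge (p : Fin k × Fin k) : Option φ.edges :=
  if h : ∃ J : φ.edges, p.1 ∈ meeting ψ J.1 ∧ p.2 ∈ meeting ψ J.1 then some h.choose else none

open Classical in
/-- The pairs whose weight is accounted for in the relation for `J` (or in no relation). -/
noncomputable def pairsOf (J : Option φ.edges) : Finset (Fin k × Fin k) :=
  Finset.univ.filter fun p => p.1 < p.2 ∧ pairEdge φ ψ p = J

theorem mem_pairsOf_some {J : φ.edges} {p : Fin k × Fin k} (hp : p ∈ pairsOf φ ψ (some J)) :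
    p.1 ∈ meeting ψ J.1 ∧ p.2 ∈ meeting ψ J.1 := by
  obtain ⟨-, -, hp⟩ := Finset.mem_filter.1 hp
  rw [pairEdge] at hp
  split_ifs at hp with h
  cases hp
  exact h.choose_spec

/-- If two sets intersect, a hyperedge of the query covering a common variable meets both; so an
uncharged pair can touch only through the added hyperedge. -/
theorem mem_pairsOf_none {ψ : Fin k → Finset (Fin n)}
    (hψ : IsCliqueEmbedding (insert φ.head φ.edges) ψ) {p : Fin k × Fin k}
    (hp : p ∈ pairsOf φ ψ none) : p.1 ∈ meeting ψ φ.head ∧ p.2 ∈ meeting ψ φ.head := by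
  obtain ⟨-, hlt, hp⟩ := Finset.mem_filter.1 hp
  rw [pairEdge] at hp
  split_ifs at hp with h
  rcases hψ.touch p.1 p.2 hlt.ne with ⟨i, hi⟩ | ⟨e, he, h1, h2⟩
  · rw [Finset.mem_inter] at hi
    obtain ⟨J, hJ, hiJ⟩ := φ.cover i
    exact absurd ⟨⟨J, hJ⟩, mem_meeting.2 ⟨i, Finset.mem_inter.2 ⟨hi.1, hiJ⟩⟩,
      mem_meeting.2 ⟨i, Finset.mem_inter.2 ⟨hi.2, hiJ⟩⟩⟩ h
  · rw [Finset.inter_comm, ← mem_meeting] at h1 h2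
    rcases Finset.mem_insert.1 he with rfl | he
    · exact ⟨h1, h2⟩
    · exact absurd ⟨⟨e, he⟩, h1, h2⟩ h

/-- The total weight of all pairs. -/
def pairWeight (a : Fin k → ℕ) : ℕ :=
  ∑ p : Fin k × Fin k with p.1 < p.2, wt (a p.1) (a p.2)

/-- The fibres of `pairEdge` partition the pairs, so nothing is charged twice. -/
theorem pairWeight_eq (a : Fin k → ℕ) :
    pairWeight wt a = ∑ J : φ.edges, ∑ p ∈ pairsOf φ ψ (some J), wt (a p.1) (a p.2) +
      ∑ p ∈ pairsOf φ ψ none, wt (a p.1) (a p.2) := by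
  classical
  rw [pairWeight, ← Finset.sum_fiberwise _ (pairEdge φ ψ), Fintype.sum_option, add_comm]
  simp only [pairsOf, Finset.filter_filter]

/-- The annotation in row `r` of the relation for `J`. -/
noncomputable def rowWeight (J : φ.edges) (r : ℕ) : ℕ :=
  ∑ p ∈ pairsOf φ ψ (some J), wt (rowDigit ψ N J.1 r p.1) (rowDigit ψ N J.1 r p.2)

/-- The listing of the relation for `J`. -/
noncomputable def rows (J : φ.edges) : List ((J.1 → ℕ) × ℕ) :=
  (List.range (N ^ weakEdgeDepth ψ J.1)).map fun r =>
    (rowTuple ψ N J.1 r, rowWeight φ ψ N wt J r)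

/-- The database of a weighted graph. -/
noncomputable def graphDatabase : φ.Database Trop := fun J => relationOfList (rows φ ψ N wt J)

variable {N} in
theorem isListing_rows (hN : 0 < N) (J : φ.edges) :
    IsListing (rows φ ψ N wt J) (graphDatabase φ ψ N wt J) := by
  refine isListing_relationOfList _ ?_
  rw [rows, List.map_map]
  refine List.Nodup.map_on ?_ List.nodup_range
  intro r hr r' hr' h
  exact rowTuple_injOn ψ N hN (List.mem_range.1 hr) (List.mem_range.1 hr') h

theorem IsListing.card_support {J : Finset (Fin n)} {L : List ((J → ℕ) × ℕ)}
    {R : SRelation Trop J} (h : IsListing L R) : R.support.card = L.length := by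
  classical
  have : R.support = (L.map Prod.fst).toFinset := by
    ext t
    rw [List.mem_toFinset, h.2.1, Finsupp.mem_support_iff]
  rw [this, List.toFinset_card_of_nodup h.1, List.length_map]

variable {N} in
theorem size_graphDatabase (hN : 0 < N) :
    (graphDatabase φ ψ N wt).size = ∑ J : φ.edges, N ^ weakEdgeDepth ψ J.1 := by
  refine Finset.sum_congr rfl fun J _ => ?_
  rw [(isListing_rows φ ψ wt hN J).card_support, rows, List.length_map, List.length_range]

variable {N} in
theorem graphDatabase_ne_zero (hN : 0 < N) {J : φ.edges} {t : J.1 → ℕ}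
    (h : graphDatabase φ ψ N wt J t ≠ 0) : ∃ r < N ^ weakEdgeDepth ψ J.1, t = rowTuple ψ N J.1 r ∧
      graphDatabase φ ψ N wt J t = Tropical.trop (rowWeight φ ψ N wt J r : ℝ≥0∞) := by
  have hL := isListing_rows φ ψ wt hN J
  obtain ⟨p, hp, rfl⟩ := List.mem_map.1 ((hL.2.1 t).2 h)
  rw [hL.2.2 p hp]
  obtain ⟨r, hr, rfl⟩ := List.mem_map.1 hp
  exact ⟨r, List.mem_range.1 hr, rfl, rfl⟩

variable {N} in
theorem graphDatabase_code {a : Fin k → ℕ} (ha : ∀ v, a v < N) (hN : 0 < N) (J : φ.edges) :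
    graphDatabase φ ψ N wt J (J.1.restrict (code ψ N a)) =
      Tropical.trop ((∑ p ∈ pairsOf φ ψ (some J), wt (a p.1) (a p.2) : ℕ) : ℝ≥0∞) := by
  obtain ⟨r, hr, h⟩ := exists_rowDigit_eq ψ ha J.1
  have ht : J.1.restrict (code ψ N a) = rowTuple ψ N J.1 r :=
    funext fun i => (code_congr ψ N h i.2).symm
  have hw : ∑ p ∈ pairsOf φ ψ (some J), wt (a p.1) (a p.2) = rowWeight φ ψ N wt J r :=
    Finset.sum_congr rfl fun p hp => by
      rw [h _ (mem_pairsOf_some φ ψ hp).1, h _ (mem_pairsOf_some φ ψ hp).2]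
  rw [ht, hw]
  exact (isListing_rows φ ψ wt hN J).2.2 (_, _)
    (List.mem_map.2 ⟨r, List.mem_range.2 hr, rfl⟩)

/-- The additional weight of a head tuple: the weight of the pairs that are not accounted for in
any relation, and a penalty for inconsistent encodings. -/
def headWeight (big : ℕ) (rep : Fin k → Fin n) (P : Finset (Fin k × Fin k)) (F : Finset (Fin n))
    (z : Fin n → ℕ) : ℕ :=
  ∑ p ∈ P, wt (digit N (z (rep p.1)) p.1) (digit N (z (rep p.2)) p.2) +
    ∑ v, ∑ i ∈ ψ v ∩ F, ∑ j ∈ ψ v ∩ F, if digit N (z j) v < digit N (z i) v then big else 0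

/-- The extension of a tuple by zeros. -/
def extendTuple {F : Finset (Fin n)} (t : F → ℕ) (i : Fin n) : ℕ :=
  if h : i ∈ F then t ⟨i, h⟩ else 0

theorem extendTuple_of_mem {F : Finset (Fin n)} (t : F → ℕ) {i : Fin n} (h : i ∈ F) :
    extendTuple t i = t ⟨i, h⟩ := dif_pos h

/-! ### Answer rows versus assignments -/

variable {φ ψ N wt}

/-- The valuation `code ψ N a` competes in the minimum that annotates its head tuple. The digits
read off this tuple are those of `a`, so no penalty arises and the uncharged pairs get their exact
weight. -/
theorem exists_row_le {big : ℕ} {rep : Fin k → Fin n} {L : List ((φ.head → ℕ) × ℕ)}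
    (hψ : IsCliqueEmbedding (insert φ.head φ.edges) ψ) (hN : 0 < N)
    (hrep : ∀ v ∈ meeting ψ φ.head, rep v ∈ ψ v ∩ φ.head)
    (hL : IsListing L (φ.eval (graphDatabase φ ψ N wt))) {a : Fin k → ℕ} (ha : ∀ v, a v < N) :
    ∃ p ∈ L, p.2 + headWeight ψ N wt big rep (pairsOf φ ψ none) φ.head (extendTuple p.1) ≤
      pairWeight wt a := by
  generalize hDdef : graphDatabase φ ψ N wt = D at hL
  have hprod : ∏ J : φ.edges, D J (J.1.restrict (code ψ N a)) =
      Tropical.trop ((∑ J : φ.edges, ∑ p ∈ pairsOf φ ψ (some J), wt (a p.1) (a p.2) : ℕ) : ℝ≥0∞) := by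
    rw [← prod_trop_natCast]
    exact Finset.prod_congr rfl fun J _ => hDdef ▸ graphDatabase_code φ ψ wt ha hN J
  have hle := φ.untrop_eval_le D (code ψ N a)
  rw [hprod, Tropical.untrop_trop] at hle
  have hne : φ.eval D (φ.head.restrict (code ψ N a)) ≠ 0 := by
    intro h
    rw [h] at hle
    exact (ENNReal.natCast_ne_top _) (top_le_iff.1 hle)
  obtain ⟨p, hp, hpt⟩ := List.mem_map.1 ((hL.2.1 _).2 hne)
  refine ⟨p, hp, ?_⟩
  rw [← hpt, hL.2.2 p hp, Tropical.untrop_trop, Nat.cast_le] at hle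
  rw [pairWeight_eq φ ψ]
  have hz : ∀ v, ∀ i ∈ ψ v ∩ φ.head, digit N (extendTuple p.1 i) v = a v := by
    intro v i hi
    rw [Finset.mem_inter] at hi
    rw [extendTuple_of_mem _ hi.2, hpt]
    exact digit_code ψ ha hi.1
  refine add_le_add hle (le_of_eq ?_)
  rw [headWeight, Finset.sum_eq_zero (s := Finset.univ), add_zero]
  · refine Finset.sum_congr rfl fun q hq => ?_
    have := mem_pairsOf_none φ hψ hq
    rw [hz _ _ (hrep _ this.1), hz _ _ (hrep _ this.2)]
  · refine fun v _ => Finset.sum_eq_zero fun i hi => Finset.sum_eq_zero fun j hj => ?_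
    rw [hz v i hi, hz v j hj, if_neg (lt_irrefl _)]

theorem eq_of_connected {E : Finset (Finset (Fin n))} {X : Finset (Fin n)} {α : Type*}
    (hX : ((primalGraph E).induce (X : Set (Fin n))).Connected) {f : Fin n → α}
    (hf : ∀ e ∈ E, ∀ i ∈ e, ∀ j ∈ e, i ∈ X → j ∈ X → f i = f j) {i j : Fin n} (hi : i ∈ X)
    (hj : j ∈ X) : f i = f j := by
  obtain ⟨w⟩ := hX.preconnected ⟨i, hi⟩ ⟨j, hj⟩
  have : ∀ {u v : (X : Set (Fin n))}, ((primalGraph E).induce (X : Set (Fin n))).Walk u v →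
      f u = f v := by
    intro u v w
    induction w with
    | nil => rfl
    | @cons u v _ h _ ih =>
      obtain ⟨-, e, he, h1, h2⟩ := h
      exact (hf e he u h1 v h2 u.2 v.2).trans ih
  exact this w

/-- An optimal valuation `z` for the row has consistent digits inside each hyperedge of the query,
since its restriction is a row there, and inside the head, since the score is below `big`.
Connectedness of `ψ v` spreads the agreement over `ψ v`, so the digits define an assignment whose
weight is the score. -/
theorem exists_pairWeight_eq {big : ℕ} {rep : Fin k → Fin n} {L : List ((φ.head → ℕ) × ℕ)}
    (hψ : IsCliqueEmbedding (insert φ.head φ.edges) ψ) (hN : 0 < N)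
    (hrep : ∀ v ∈ meeting ψ φ.head, rep v ∈ ψ v ∩ φ.head)
    (hL : IsListing L (φ.eval (graphDatabase φ ψ N wt))) {p : (φ.head → ℕ) × ℕ} (hp : p ∈ L)
    (hlt : p.2 + headWeight ψ N wt big rep (pairsOf φ ψ none) φ.head (extendTuple p.1) < big) :
    ∃ a : Fin k → ℕ, (∀ v, a v < N) ∧ pairWeight wt a =
      p.2 + headWeight ψ N wt big rep (pairsOf φ ψ none) φ.head (extendTuple p.1) := by
  generalize hDdef : graphDatabase φ ψ N wt = D at hL
  have hval : φ.eval D p.1 = Tropical.trop (p.2 : ℝ≥0∞) := hL.2.2 p hp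
  have hne : φ.eval D p.1 ≠ 0 := hval ▸ trop_natCast_ne_zero _
  obtain ⟨z, hz, heq⟩ := φ.exists_eval_eq D hne
  rw [heq] at hval hne
  have hJ : ∀ J : φ.edges, D J (J.1.restrict z) ≠ 0 := fun J h0 =>
    hne (Finset.prod_eq_zero (Finset.mem_univ J) h0)
  subst hDdef
  choose r hr ht hD using fun J => graphDatabase_ne_zero φ ψ wt hN (hJ J)
  have hsum : p.2 = ∑ J : φ.edges, rowWeight φ ψ N wt J (r J) := by
    have h1 : ∏ J : φ.edges, graphDatabase φ ψ N wt J (J.1.restrict z) =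
        Tropical.trop ((∑ J : φ.edges, rowWeight φ ψ N wt J (r J) : ℕ) : ℝ≥0∞) := by
      rw [← prod_trop_natCast]
      exact Finset.prod_congr rfl fun J _ => hD J
    exact_mod_cast Tropical.trop_injective (hval.symm.trans h1)
  have hrow : ∀ (J : φ.edges) (v : Fin k) (i : Fin n), i ∈ ψ v → i ∈ J.1 →
      digit N (z i) v = rowDigit ψ N J.1 (r J) v := by
    intro J v i hi hiJ
    have := congrFun (ht J) ⟨i, hiJ⟩
    change z i = code ψ N _ i at this
    rw [this, digit_code ψ (rowDigit_lt ψ hN J.1 (r J)) hi]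
  have hext : ∀ i ∈ φ.head, extendTuple p.1 i = z i := by
    intro i hi
    rw [extendTuple_of_mem _ hi, ← (show φ.head.restrict z = p.1 from hz)]
    rfl
  -- One violated inequality already contributes `big` to the score. The penalty runs over ordered
  -- pairs, so equality follows by symmetry.
  have hhead : ∀ v, ∀ i ∈ ψ v ∩ φ.head, ∀ j ∈ ψ v ∩ φ.head,
      digit N (z i) v ≤ digit N (z j) v := by
    intro v i hi j hj
    by_contra! h
    have h1 : (if digit N (extendTuple p.1 j) v < digit N (extendTuple p.1 i) v then big else 0)
        = big := by
      rw [hext i (Finset.mem_inter.1 hi).2, hext j (Finset.mem_inter.1 hj).2, if_pos h]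
    have h2 := Finset.single_le_sum (f := fun j =>
      if digit N (extendTuple p.1 j) v < digit N (extendTuple p.1 i) v then big else 0)
      (fun _ _ => Nat.zero_le _) hj
    have h3 := Finset.single_le_sum (f := fun i => ∑ j ∈ ψ v ∩ φ.head,
      if digit N (extendTuple p.1 j) v < digit N (extendTuple p.1 i) v then big else 0)
      (fun _ _ => Nat.zero_le _) hi
    have h4 := Finset.single_le_sum (f := fun v => ∑ i ∈ ψ v ∩ φ.head, ∑ j ∈ ψ v ∩ φ.head,
      if digit N (extendTuple p.1 j) v < digit N (extendTuple p.1 i) v then big else 0)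
      (fun _ _ => Nat.zero_le _) (Finset.mem_univ v)
    simp only [h1] at h2
    simp only [headWeight] at hlt
    omega
  -- The variable `s v` is an arbitrary reference point of `ψ v` from which the digit of `v` is
  -- read.
  choose s hs using hψ.nonempty
  have hdig : ∀ (v : Fin k) (i : Fin n), i ∈ ψ v → digit N (z i) v = digit N (z (s v)) v := by
    intro v i hi
    refine eq_of_connected (f := fun i => digit N (z i) v) (hψ.connected v) ?_ hi (hs v)
    intro e he i hie j hje hi hj
    rcases Finset.mem_insert.1 he with rfl | he
    · exact le_antisymm
        (hhead v i (Finset.mem_inter.2 ⟨hi, hie⟩) j (Finset.mem_inter.2 ⟨hj, hje⟩))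
        (hhead v j (Finset.mem_inter.2 ⟨hj, hje⟩) i (Finset.mem_inter.2 ⟨hi, hie⟩))
    · exact (hrow ⟨e, he⟩ v i hi hie).trans (hrow ⟨e, he⟩ v j hj hje).symm
  refine ⟨fun v => digit N (z (s v)) v, fun v => Nat.mod_lt _ hN, ?_⟩
  have hmeet : ∀ (J : φ.edges), ∀ v ∈ meeting ψ J.1,
      rowDigit ψ N J.1 (r J) v = digit N (z (s v)) v := by
    intro J v hv
    obtain ⟨i, hi⟩ := mem_meeting.1 hv
    rw [Finset.mem_inter] at hi
    rw [← hrow J v i hi.1 hi.2, hdig v i hi.1]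
  have hrepdig : ∀ v ∈ meeting ψ φ.head,
      digit N (extendTuple p.1 (rep v)) v = digit N (z (s v)) v := by
    intro v hv
    have := Finset.mem_inter.1 (hrep v hv)
    rw [hext _ this.2, hdig v _ this.1]
  rw [pairWeight_eq φ ψ, hsum, headWeight, Finset.sum_eq_zero (s := Finset.univ (α := Fin k)),
    add_zero]
  · congr 1
    · refine Finset.sum_congr rfl fun J _ => Finset.sum_congr rfl fun q hq => ?_
      have := mem_pairsOf_some φ ψ hq
      rw [hmeet J _ this.1, hmeet J _ this.2]
    · refine Finset.sum_congr rfl fun q hq => ?_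
      have := mem_pairsOf_none φ hψ hq
      rw [hrepdig _ this.1, hrepdig _ this.2]
  · refine fun v _ => Finset.sum_eq_zero fun i hi => Finset.sum_eq_zero fun j hj => ?_
    rw [hext i (Finset.mem_inter.1 hi).2, hext j (Finset.mem_inter.1 hj).2,
      if_neg (hhead v i hi j hj).not_gt]

/-- The assignment comes from a row of one relation covering `i` and may differ from one head
variable to another. -/
theorem mem_support_eval_entry {t : φ.head → ℕ} (hN : 0 < N)
    (ht : φ.eval (graphDatabase φ ψ N wt) t ≠ 0) (i : φ.head) :
    ∃ a : Fin k → ℕ, (∀ v, a v < N) ∧ t i = code ψ N a i := by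
  obtain ⟨z, hz, h0⟩ := exists_ne_zero_of_finsum_mem_ne_zero ht
  obtain ⟨J, hJ, hi⟩ := φ.cover i
  obtain ⟨r, hr, ht, -⟩ := graphDatabase_ne_zero φ ψ wt hN (J := ⟨J, hJ⟩)
    (t := J.restrict z) fun h => h0 (Finset.prod_eq_zero (Finset.mem_univ ⟨J, hJ⟩) h)
  refine ⟨_, rowDigit_lt ψ hN J r, ?_⟩
  have h1 := congrFun ht ⟨i, hi⟩
  have h2 : t i = z i := by rw [← (show φ.head.restrict z = t from hz)]; rfl
  exact h2.trans h1

/-- Entries are counted independently: only the digits of the `v` with `i ∈ ψ v` affect entry `i`.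
The exponents add up to the edge depth, not the weak edge depth, of the head. -/
theorem card_support_eval_le (hN : 0 < N) :
    (φ.eval (graphDatabase φ ψ N wt)).support.card ≤ N ^ edgeDepth ψ φ.head := by
  classical
  let C : φ.head → Finset ℕ := fun i =>
    (Finset.univ : Finset ((meeting ψ {i.1}) → Fin N)).image fun a =>
      code ψ N (fun v => if h : v ∈ meeting ψ {i.1} then a ⟨v, h⟩ else 0) i
  have hC : ∀ i, (C i).card ≤ N ^ weakEdgeDepth ψ {i.1} := fun i => by
    refine Finset.card_image_le.trans (le_of_eq ?_)
    rw [Finset.card_univ, Fintype.card_fun, Fintype.card_fin, Fintype.card_coe]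
    rfl
  have hsub : (φ.eval (graphDatabase φ ψ N wt)).support ⊆ Fintype.piFinset C := by
    intro t ht
    rw [Fintype.mem_piFinset]
    intro i
    obtain ⟨a, ha, h⟩ := mem_support_eval_entry hN (Finsupp.mem_support_iff.1 ht) i
    refine Finset.mem_image.2 ⟨fun v => ⟨a v, ha v⟩, Finset.mem_univ _, ?_⟩
    rw [h]
    exact code_congr ψ N (J := {i.1}) (fun v hv => by simp [hv]) (Finset.mem_singleton_self _)
  calc _ ≤ _ := Finset.card_le_card hsub
    _ = ∏ i : φ.head, (C i).card := Fintype.card_piFinset C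
    _ ≤ ∏ i : φ.head, N ^ weakEdgeDepth ψ {i.1} := Finset.prod_le_prod' fun i _ => hC i
    _ = N ^ edgeDepth ψ φ.head := by
      rw [Finset.prod_pow_eq_pow_sum, edgeDepth, ← Finset.sum_coe_sort φ.head fun i => weakEdgeDepth ψ {i}]

end Database

/-! ### Random access to encodings -/

theorem List.length_flatMap_of_uniform {α β : Type*} {W : ℕ} (l : List α) (f : α → List β)
    (h : ∀ x ∈ l, (f x).length = W) : (l.flatMap f).length = l.length * W := by
  induction l with
  | nil => simp
  | cons x l ih =>
    rw [List.flatMap_cons, List.length_append, ih fun y hy => h y (List.mem_cons_of_mem _ hy),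
      h x List.mem_cons_self, List.length_cons]
    ring

theorem List.getD_flatMap_of_uniform {α β : Type*} {W : ℕ} (l : List α) (f : α → List β)
    (h : ∀ x ∈ l, (f x).length = W) (d : β) {i j : ℕ} (hi : i < l.length) (hj : j < W) :
    (l.flatMap f).getD (i * W + j) d = (f l[i]).getD j d := by
  induction l generalizing i with
  | nil => simp at hi
  | cons x l ih =>
    have hx := h x List.mem_cons_self
    rw [List.flatMap_cons]
    cases i with
    | zero => simpa using List.getD_append _ _ d j (by omega)
    | succ i =>
      have hle : (f x).length ≤ (i + 1) * W + j := by rw [hx]; nlinarith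
      rw [List.getD_append_right _ _ d _ hle, hx,
        show (i + 1) * W + j - W = i * W + j by rw [add_mul, one_mul]; omega,
        ih (fun y hy => h y (List.mem_cons_of_mem _ hy)) (by simpa using hi)]
      rfl

namespace RAM.Ex

def pow (a : Ex) : ℕ → Ex
  | 0 => const 1
  | m + 1 => op .mul (pow a m) a

def mod (a b : Ex) : Ex := op .sub a (op .mul (op .div a b) b)

def sum : List Ex → Ex
  | [] => const 0
  | e :: es => op .add e (sum es)

noncomputable def fsum {ι : Type*} (s : Finset ι) (f : ι → Ex) : Ex := sum (s.toList.map f)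

/-- The digit at position `v` in base `N`, where `N` is the value of the first variable. -/
def digit (e : Ex) (v : ℕ) : Ex := mod (op .div e (pow (var 0) v)) (var 0)

/-- The entry of a list of expressions at a given position. -/
def select : List Ex → Ex → Ex
  | [], _ => const 0
  | e :: es, j => ite j (select es (op .sub j (const 1))) e

variable {ρ : Fin 4 → ℤ} {μ : ℕ → ℤ} {l : List ℤ} {a b : Ex} {x y : ℕ}

theorem eval_add (ha : a.eval ρ μ l = x) (hb : b.eval ρ μ l = y) :
    (op .add a b).eval ρ μ l = (x + y : ℕ) := by
  simp [eval, ArithOp.eval, ha, hb]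

theorem eval_mul (ha : a.eval ρ μ l = x) (hb : b.eval ρ μ l = y) :
    (op .mul a b).eval ρ μ l = (x * y : ℕ) := by
  simp [eval, ArithOp.eval, ha, hb]

theorem eval_div (ha : a.eval ρ μ l = x) (hb : b.eval ρ μ l = y) :
    (op .div a b).eval ρ μ l = (x / y : ℕ) := by
  simp [eval, ArithOp.eval, ha, hb]

theorem eval_sub (ha : a.eval ρ μ l = x) (hb : b.eval ρ μ l = y) (h : y ≤ x) :
    (op .sub a b).eval ρ μ l = (x - y : ℕ) := by
  simp [eval, ArithOp.eval, ha, hb, h]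

theorem eval_ite_sub {c d : Ex} (ha : a.eval ρ μ l = x) (hb : b.eval ρ μ l = y) :
    (ite (op .sub a b) c d).eval ρ μ l = if y < x then c.eval ρ μ l else d.eval ρ μ l := by
  simp [eval, ArithOp.eval, ha, hb]

theorem eval_pow (ha : a.eval ρ μ l = x) (m : ℕ) : (pow a m).eval ρ μ l = (x ^ m : ℕ) := by
  induction m with
  | zero => simp [pow, eval]
  | succ m ih => rw [pow, eval_mul ih ha, pow_succ]

theorem eval_mod (ha : a.eval ρ μ l = x) (hb : b.eval ρ μ l = y) :
    (mod a b).eval ρ μ l = (x % y : ℕ) := by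
  rw [mod, eval, eval_mul (eval_div ha hb) hb, ha]
  simp only [ArithOp.eval]
  push_cast
  rw [Int.emod_def, mul_comm]

theorem eval_sum (es : List Ex) : (sum es).eval ρ μ l = (es.map fun e => e.eval ρ μ l).sum := by
  induction es with
  | nil => rfl
  | cons e es ih => simp [sum, eval, ArithOp.eval, ih]

theorem eval_fsum {ι : Type*} {s : Finset ι} {f : ι → Ex} {g : ι → ℕ}
    (h : ∀ i ∈ s, (f i).eval ρ μ l = g i) : (fsum s f).eval ρ μ l = (∑ i ∈ s, g i : ℕ) := by
  rw [fsum, eval_sum, List.map_map, Nat.cast_sum]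
  exact (Finset.sum_map_toList s _).trans (Finset.sum_congr rfl h)

theorem eval_digit {N : ℕ} (h0 : ρ 0 = N) (ha : a.eval ρ μ l = x) {k : ℕ} (v : Fin k) :
    (digit a v).eval ρ μ l = (_root_.digit N x v : ℕ) :=
  eval_mod (eval_div ha (eval_pow (by simpa [eval] using h0) _)) (by simpa [eval] using h0)

theorem eval_select (es : List Ex) {j : Ex} (hj : j.eval ρ μ l = x) :
    (select es j).eval ρ μ l = (es.map fun e => e.eval ρ μ l).getD x 0 := by
  induction es generalizing j x with
  | nil => simp [select, eval]
  | cons e es ih =>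
    rw [select, eval, hj]
    cases x with
    | zero => simp
    | succ x =>
      rw [if_pos (by positivity), ih (x := x)]
      · simp
      · rw [eval_sub hj (y := 1) (by simp [eval]) (by omega)]; simp

/-- With `N` in the first variable and input `l`, the expression `acc e` computes the entry of `L`
at the position that is computed by `e`. -/
def Accesses (N : ℕ) (l : List ℤ) (acc : Ex → Ex) (L : List ℤ) : Prop :=
  ∀ (ρ : Fin 4 → ℤ) (μ : ℕ → ℤ), ρ 0 = N → ∀ (e : Ex) (x : ℕ), e.eval ρ μ l = x →
    (acc e).eval ρ μ l = L.getD x 0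

def accCons (h : Ex) (acc : Ex → Ex) (e : Ex) : Ex := ite e (acc (op .sub e (const 1))) h

def accAppend (len : Ex) (acc acc' : Ex → Ex) (e : Ex) : Ex :=
  ite (op .sub len e) (acc e) (acc' (op .sub e len))

/-- Access to a sequence of `count` rows of length `W`. -/
def accRows (count : Ex) (W : ℕ) (row : Ex → List Ex) (e : Ex) : Ex :=
  ite (op .sub (op .mul count (const W)) e)
    (select (row (op .div e (const W))) (mod e (const W))) (const 0)

variable {N : ℕ}

theorem accesses_accCons {h : Ex} {acc : Ex → Ex} {z : ℤ} {L : List ℤ}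
    (hh : ∀ (ρ : Fin 4 → ℤ) (μ : ℕ → ℤ), ρ 0 = N → h.eval ρ μ l = z) (hacc : Accesses N l acc L) :
    Accesses N l (accCons h acc) (z :: L) := by
  intro ρ μ h0 e x hx
  rw [accCons, eval, hx]
  cases x with
  | zero => simpa using hh ρ μ h0
  | succ x =>
    rw [if_pos (by positivity), hacc ρ μ h0 _ x]
    · simp
    · rw [eval_sub hx (y := 1) (by simp [eval]) (by omega)]; simp

theorem accesses_accAppend {len : Ex} {acc acc' : Ex → Ex} {L L' : List ℤ}
    (hlen : ∀ (ρ : Fin 4 → ℤ) (μ : ℕ → ℤ), ρ 0 = N → len.eval ρ μ l = L.length)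
    (hacc : Accesses N l acc L) (hacc' : Accesses N l acc' L') :
    Accesses N l (accAppend len acc acc') (L ++ L') := by
  intro ρ μ h0 e x hx
  rw [accAppend, eval_ite_sub (hlen ρ μ h0) hx]
  split_ifs with h
  · rw [hacc ρ μ h0 e x hx, List.getD_append _ _ _ _ h]
  · rw [not_lt] at h
    rw [hacc' ρ μ h0 _ _ (eval_sub hx (hlen ρ μ h0) h), List.getD_append_right _ _ _ _ h]

/-- Position `x` lies in row `x / W` at column `x % W`. The guard returns 0 past the end, as a read
of the real input would. -/
theorem accesses_accRows {count : Ex} {W R : ℕ} {row : Ex → List Ex} {f : ℕ → List ℤ}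
    (hcount : ∀ (ρ : Fin 4 → ℤ) (μ : ℕ → ℤ), ρ 0 = N → count.eval ρ μ l = R)
    (hf : ∀ r < R, (f r).length = W)
    (hrow : ∀ (ρ : Fin 4 → ℤ) (μ : ℕ → ℤ), ρ 0 = N → ∀ (e : Ex) (r : ℕ), r < R →
      e.eval ρ μ l = r → (row e).map (fun e => e.eval ρ μ l) = f r) :
    Accesses N l (accRows count W row) ((List.range R).flatMap f) := by
  intro ρ μ h0 e x hx
  have hW : (const W).eval ρ μ l = W := by simp [eval]
  have hf' : ∀ r ∈ List.range R, (f r).length = W := fun r hr => hf r (List.mem_range.1 hr)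
  rw [accRows, eval_ite_sub (eval_mul (hcount ρ μ h0) hW) hx]
  split_ifs with h
  · have hW0 : 0 < W := Nat.pos_of_ne_zero fun h' => by simp [h'] at h
    have hr : x / W < R := Nat.div_lt_of_lt_mul (by rwa [mul_comm])
    rw [eval_select _ (eval_mod hx hW), hrow ρ μ h0 _ _ hr (eval_div hx hW)]
    conv_rhs => rw [← Nat.div_add_mod x W, mul_comm]
    rw [List.getD_flatMap_of_uniform _ _ hf' 0 (by simpa using hr) (Nat.mod_lt _ hW0)]
    simp
  · rw [List.getD_eq_default]
    · simp [eval]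
    · rw [List.length_flatMap_of_uniform _ _ hf', List.length_range]
      omega

end RAM.Ex

/-! ### Computing entries of the virtual database -/

section DatabaseAccess

open RAM Ex

variable {n k : ℕ} (φ : FAQ n) (ψ : Fin k → Finset (Fin n)) (wE : Ex → Ex → Ex)

/-- `wE` computes the function `wt` on numbers less than `N`. -/
def ComputesWeight (N : ℕ) (l : List ℤ) (wt : ℕ → ℕ → ℕ) : Prop :=
  ∀ (ρ : Fin 4 → ℤ) (μ : ℕ → ℤ), ρ 0 = N → ∀ (e e' : Ex) (a b : ℕ), a < N → b < N →
    e.eval ρ μ l = a → e'.eval ρ μ l = b → (wE e e').eval ρ μ l = wt a b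

-- The case distinction is made while the expression is built: `ψ` and `J` are fixed with the query,
-- so the expression does not depend on the graph.
open Classical in
noncomputable def rowDigitEx (J : Finset (Fin n)) (r : Ex) (v : Fin k) : Ex :=
  if v ∈ meeting ψ J then digit r (meetingRank ψ J v) else const 0

noncomputable def codeEx (a : Fin k → Ex) (i : Fin n) : Ex :=
  fsum Finset.univ fun v => if i ∈ ψ v then op .mul (a v) (pow (var 0) v) else const 0

noncomputable def rowEx (J : φ.edges) (r : Ex) : List Ex :=
  List.ofFn (fun j => codeEx ψ (rowDigitEx ψ J.1 r) (J.1.orderIsoOfFin rfl j)) ++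
    [fsum (pairsOf φ ψ (some J)) fun p =>
      wE (rowDigitEx ψ J.1 r p.1) (rowDigitEx ψ J.1 r p.2)]

noncomputable def accRelation (J : φ.edges) : Ex → Ex :=
  accCons (pow (var 0) (weakEdgeDepth ψ J.1))
    (accRows (pow (var 0) (weakEdgeDepth ψ J.1)) (J.1.card + 1) (rowEx φ ψ wE J))

noncomputable def accRelations : List φ.edges → Ex → Ex
  | [] => fun _ => const 0
  | J :: Js => accAppend
      (op .add (op .mul (pow (var 0) (weakEdgeDepth ψ J.1)) (const (J.1.card + 1 : ℕ))) (const 1))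
      (accRelation φ ψ wE J) (accRelations Js)

/-- Access to the encoding of the database of a graph. -/
noncomputable def accDatabase : Ex → Ex := accRelations φ ψ wE Finset.univ.toList

variable {φ ψ wE} {N : ℕ} {l : List ℤ} {wt : ℕ → ℕ → ℕ}

theorem eval_rowDigitEx {ρ : Fin 4 → ℤ} {μ : ℕ → ℤ} (h0 : ρ 0 = N) (J : Finset (Fin n)) {e : Ex}
    {r : ℕ} (he : e.eval ρ μ l = r) (v : Fin k) :
    (rowDigitEx ψ J e v).eval ρ μ l = rowDigit ψ N J r v := by
  have hv : (var 0).eval ρ μ l = N := by simpa [eval] using h0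
  rw [rowDigitEx, rowDigit]
  split_ifs
  · exact eval_mod (eval_div he (eval_pow hv _)) hv
  · simp [eval]

theorem eval_codeEx {ρ : Fin 4 → ℤ} {μ : ℕ → ℤ} (h0 : ρ 0 = N) {a : Fin k → Ex} {b : Fin k → ℕ}
    (h : ∀ v, (a v).eval ρ μ l = b v) (i : Fin n) :
    (codeEx ψ a i).eval ρ μ l = code ψ N b i := by
  refine eval_fsum fun v _ => ?_
  split_ifs
  · exact eval_mul (h v) (eval_pow (by simpa [eval] using h0) _)
  · simp [eval]

theorem encodeRows_rows (J : φ.edges) : encodeRows (rows φ ψ N wt J) =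
    (List.range (N ^ weakEdgeDepth ψ J.1)).flatMap fun r =>
      List.ofFn (fun j => (rowTuple ψ N J.1 r (J.1.orderIsoOfFin rfl j) : ℤ)) ++
        [(rowWeight φ ψ N wt J r : ℤ)] := by
  rw [encodeRows, rows, List.flatMap_map]

theorem length_encodeRows {J : Finset (Fin n)} (L : List ((J → ℕ) × ℕ)) :
    (encodeRows L).length = L.length * (J.card + 1) :=
  List.length_flatMap_of_uniform _ _ fun p _ => by simp

theorem accesses_accRelation (hN : 0 < N) (hw : ComputesWeight wE N l wt) (J : φ.edges) :
    Accesses N l (accRelation φ ψ wE J)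
      (((rows φ ψ N wt J).length : ℤ) :: encodeRows (rows φ ψ N wt J)) := by
  have hpow : ∀ (ρ : Fin 4 → ℤ) (μ : ℕ → ℤ), ρ 0 = N →
      (pow (var 0) (weakEdgeDepth ψ J.1)).eval ρ μ l = (N ^ weakEdgeDepth ψ J.1 : ℕ) :=
    fun ρ μ h0 => eval_pow (by simpa [eval] using h0) _
  refine accesses_accCons (fun ρ μ h0 => ?_) ?_
  · rw [hpow ρ μ h0, rows, List.length_map, List.length_range]
  · rw [encodeRows_rows]
    refine accesses_accRows hpow (fun r _ => by simp) fun ρ μ h0 e r _ he => ?_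
    have hd := eval_rowDigitEx (ψ := ψ) (μ := μ) h0 J.1 he
    rw [rowEx, List.map_append, List.map_ofFn, List.map_singleton]
    congr 2
    · exact funext fun j => eval_codeEx h0 hd _
    · exact eval_fsum fun p _ => hw ρ μ h0 _ _ _ _ (rowDigit_lt ψ hN _ _ _)
        (rowDigit_lt ψ hN _ _ _) (hd _) (hd _)

theorem accesses_accDatabase (hN : 0 < N) (hw : ComputesWeight wE N l wt) :
    Accesses N l (accDatabase φ ψ wE) (encodeDatabase (rows φ ψ N wt)) := by
  have : ∀ Js : List φ.edges, Accesses N l (accRelations φ ψ wE Js) (Js.flatMap fun J =>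
      ((rows φ ψ N wt J).length : ℤ) :: encodeRows (rows φ ψ N wt J)) := by
    intro Js
    induction Js with
    | nil =>
      intro ρ μ _ e x _
      simp [accRelations, eval]
    | cons J Js ih =>
      rw [List.flatMap_cons]
      refine accesses_accAppend (fun ρ μ h0 => ?_) (accesses_accRelation hN hw J) ih
      rw [List.length_cons, length_encodeRows, rows, List.length_map, List.length_range]
      exact eval_add (y := 1) (eval_mul (eval_pow (by simpa [eval] using h0) _) (by simp [eval]))
        (by simp [eval])
  exact this _

end DatabaseAccess

/-! ### Scores of the buffered answer rows -/

section HeadWeight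

open RAM Ex

variable {n k : ℕ} (ψ : Fin k → Finset (Fin n)) (wE : Ex → Ex → Ex) (bigE : Ex)
  (F : Finset (Fin n))

/-- The entry for variable `i` of the row that ends at the position in the third variable. -/
noncomputable def entryEx (i : Fin n) : Ex :=
  if h : i ∈ F then arr (op .add (op .sub (var 2) (const (F.card + 1 : ℕ)))
    (const (((F.orderIsoOfFin rfl).symm ⟨i, h⟩ : ℕ) + 1 : ℕ))) else const 0

/-- The annotation plus the additional weight of the row that ends at the position in the third
variable. -/
noncomputable def scoreEx (rep : Fin k → Fin n) (P : Finset (Fin k × Fin k)) : Ex :=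
  op .add (arr (var 2)) (op .add
    (fsum P fun p => wE (digit (entryEx F (rep p.1)) p.1) (digit (entryEx F (rep p.2)) p.2))
    (fsum Finset.univ fun v => fsum (ψ v ∩ F) fun i => fsum (ψ v ∩ F) fun j =>
      ite (op .sub (digit (entryEx F i) v) (digit (entryEx F j) v)) bigE (const 0)))

variable {ψ wE bigE F} {N : ℕ} {l : List ℤ} {wt : ℕ → ℕ → ℕ}

theorem getD_encodeRows {L : List ((F → ℕ) × ℕ)} {r : ℕ} (hr : r < L.length) {j : ℕ}
    (hj : j < F.card + 1) : (encodeRows L).getD (r * (F.card + 1) + j) 0 =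
      (List.ofFn (fun i => (L[r].1 (F.orderIsoOfFin rfl i) : ℤ)) ++ [(L[r].2 : ℤ)]).getD j 0 :=
  List.getD_flatMap_of_uniform _ _ (fun p _ => by simp) 0 hr hj

theorem eval_entryEx {ρ : Fin 4 → ℤ} {μ : ℕ → ℤ} {L : List ((F → ℕ) × ℕ)} {r : ℕ}
    (hr : r < L.length) (h2 : ρ 2 = ((r + 1) * (F.card + 1) : ℕ))
    (hμ : ∀ a, μ (a + 1) = (encodeRows L).getD a 0) (i : Fin n) :
    (entryEx F i).eval ρ μ l = extendTuple L[r].1 i := by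
  unfold entryEx extendTuple
  split_ifs with h
  · set j := (F.orderIsoOfFin rfl).symm ⟨i, h⟩ with hj
    -- Row `r` occupies the buffer positions `r * (F.card + 1) + 1` to `(r + 1) * (F.card + 1)`,
    -- hence the 1 added to the rank of the variable.
    have he : (op .add (op .sub (var 2) (const (F.card + 1 : ℕ))) (const ((j : ℕ) + 1 : ℕ))).eval
        ρ μ l = (r * (F.card + 1) + j + 1 : ℕ) := by
      simp only [eval, ArithOp.eval, h2]
      push_cast
      ring
    rw [eval, he, if_pos (by positivity), Int.toNat_natCast, hμ,
      getD_encodeRows hr (by have := j.2; omega), List.getD_append _ _ _ _ (by simp)]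
    simp [hj]
  · simp [eval]

theorem eval_scoreEx (hN : 0 < N) (hw : ComputesWeight wE N l wt) {big : ℕ}
    (hbig : ∀ (ρ : Fin 4 → ℤ) (μ : ℕ → ℤ), ρ 0 = N → bigE.eval ρ μ l = big)
    {rep : Fin k → Fin n} {P : Finset (Fin k × Fin k)} {ρ : Fin 4 → ℤ} {μ : ℕ → ℤ}
    (h0 : ρ 0 = N) {L : List ((F → ℕ) × ℕ)} {r : ℕ} (hr : r < L.length)
    (h2 : ρ 2 = ((r + 1) * (F.card + 1) : ℕ)) (hμ : ∀ a, μ (a + 1) = (encodeRows L).getD a 0) :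
    (scoreEx ψ wE bigE F rep P).eval ρ μ l =
      (L[r].2 + headWeight ψ N wt big rep P F (extendTuple L[r].1) : ℕ) := by
  have hent := fun i => eval_entryEx (l := l) hr h2 hμ i
  refine eval_add ?_ (eval_add (eval_fsum fun p _ => ?_) (eval_fsum fun v _ => eval_fsum
    fun i _ => eval_fsum fun j _ => ?_))
  · have hv : (var 2).eval ρ μ l = (r * (F.card + 1) + F.card + 1 : ℕ) := by
      rw [eval, h2]; push_cast; ring
    rw [eval, hv, if_pos (by positivity), Int.toNat_natCast, hμ, getD_encodeRows hr (by omega),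
      List.getD_append_right _ _ _ _ (by simp)]
    simp
  · exact hw ρ μ h0 _ _ _ _ (Nat.mod_lt _ hN) (Nat.mod_lt _ hN) (eval_digit h0 (hent _) _)
      (eval_digit h0 (hent _) _)
  · rw [eval_ite_sub (eval_digit h0 (hent _) _) (eval_digit h0 (hent _) _)]
    split_ifs
    · exact hbig ρ μ h0
    · simp [eval]

end HeadWeight

/-! ### Cliques and pair weights -/

section Clique

variable {N k : ℕ} (G : SimpleGraph (Fin N)) (w : Sym2 (Fin N) → ℤ)

open Classical in
/-- The weight of an edge shifted by `W`, or `big` for pairs that are not adjacent. -/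
noncomputable def shiftedWeight (W big a b : ℕ) : ℕ :=
  if h : ∃ (ha : a < N) (hb : b < N), G.Adj ⟨a, ha⟩ ⟨b, hb⟩ then
    (w s(⟨a, h.choose⟩, ⟨b, h.choose_spec.choose⟩) + W).toNat else big

variable {G w}

theorem shiftedWeight_of_adj {W big : ℕ} {a b : Fin N} (h : G.Adj a b) :
    shiftedWeight G w W big a b = (w s(a, b) + W).toNat :=
  dif_pos ⟨a.2, b.2, h⟩

theorem shiftedWeight_of_not_adj {W big : ℕ} {a b : Fin N} (h : ¬ G.Adj a b) :
    shiftedWeight G w W big a b = big :=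
  dif_neg fun ⟨_, _, h'⟩ => h h'

theorem shiftedWeight_le {W big : ℕ} (hw : ∀ e ∈ G.edgeSet, |w e| ≤ W) (hbig : 2 * W ≤ big)
    (a b : ℕ) : shiftedWeight G w W big a b ≤ big := by
  unfold shiftedWeight
  split_ifs with h
  · have := (abs_le.1 (hw _ (G.mem_edgeSet.2 h.choose_spec.choose_spec))).2
    omega
  · exact le_rfl

/-- The number of pairs. -/
def pairCount (k : ℕ) : ℕ := (Finset.univ.filter fun p : Fin k × Fin k => p.1 < p.2).card

theorem pairCount_le (k : ℕ) : pairCount k ≤ k ^ 2 := by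
  refine (Finset.card_filter_le _ _).trans (le_of_eq ?_)
  simp [sq]

/-- By `|w e| ≤ W` the truncation `toNat` is harmless, so all cliques are shifted by the same amount
and their order is preserved. -/
theorem pairWeight_of_adj {W big : ℕ} (hw : ∀ e ∈ G.edgeSet, |w e| ≤ W) {a : Fin k → Fin N}
    (ha : ∀ u v, u < v → G.Adj (a u) (a v)) :
    (pairWeight (shiftedWeight G w W big) (fun v => a v) : ℤ) =
      ∑ p : Fin k × Fin k with p.1 < p.2, w s(a p.1, a p.2) + pairCount k * W := by
  rw [pairWeight, Nat.cast_sum, pairCount, ← nsmul_eq_mul, ← Finset.sum_const,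
    ← Finset.sum_add_distrib]
  refine Finset.sum_congr rfl fun p hp => ?_
  have hadj := ha _ _ (Finset.mem_filter.1 hp).2
  have := (abs_le.1 (hw _ (G.mem_edgeSet.2 hadj))).1
  rw [shiftedWeight_of_adj hadj, Int.toNat_of_nonneg (by omega)]

/-- There are at most `k ^ 2` pairs, and a shifted edge weight is at most `2 * W`. -/
theorem pairWeight_lt_of_adj {W big : ℕ} (hw : ∀ e ∈ G.edgeSet, |w e| ≤ W)
    (hbig : 2 * k ^ 2 * W < big) {a : Fin k → Fin N} (ha : ∀ u v, u < v → G.Adj (a u) (a v)) :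
    pairWeight (shiftedWeight G w W big) (fun v => a v) < big := by
  have h1 : pairWeight (shiftedWeight G w W big) (fun v => a v) ≤ pairCount k * (2 * W) := by
    refine Finset.sum_le_card_nsmul _ _ _ fun p hp => ?_
    have hadj := ha _ _ (Finset.mem_filter.1 hp).2
    have := (abs_le.1 (hw _ (G.mem_edgeSet.2 hadj))).2
    rw [shiftedWeight_of_adj hadj]
    omega
  have h2 := Nat.mul_le_mul_right (2 * W) (pairCount_le k)
  have h3 : k ^ 2 * (2 * W) = 2 * k ^ 2 * W := by ring
  omega

theorem adj_of_pairWeight_lt {W big : ℕ} {a : Fin k → Fin N}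
    (h : pairWeight (shiftedWeight G w W big) (fun v => a v) < big) (u v : Fin k) (huv : u < v) :
    G.Adj (a u) (a v) := by
  by_contra hadj
  have := Finset.single_le_sum
    (f := fun p : Fin k × Fin k => shiftedWeight G w W big (a p.1) (a p.2))
    (s := Finset.univ.filter fun p : Fin k × Fin k => p.1 < p.2) (fun _ _ => Nat.zero_le _)
    (Finset.mem_filter.2 ⟨Finset.mem_univ (u, v), huv⟩)
  simp only [shiftedWeight_of_not_adj hadj] at this
  rw [pairWeight] at h
  omega

/-- A clique is enumerated increasingly; conversely, pairwise adjacency makes `a` injective because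
`G` has no loops. -/
theorem mem_cliqueWeights_iff {m : ℤ} : m ∈ cliqueWeights G w k ↔
    ∃ a : Fin k → Fin N, (∀ u v, u < v → G.Adj (a u) (a v)) ∧
      m = ∑ p : Fin k × Fin k with p.1 < p.2, w s(a p.1, a p.2) := by
  have key : ∀ a : Fin k ↪ Fin N, ∑ e ∈ (Finset.univ.map a).sym2 with ¬ e.IsDiag, w e =
      ∑ p : Fin k × Fin k with p.1 < p.2, w s(a p.1, a p.2) := by
    intro a
    rw [Finset.sym2_map, Finset.filter_map, Finset.sum_map]
    have : ∀ e : Sym2 (Fin k), (¬ (a.sym2Map e).IsDiag) ↔ ¬ e.IsDiag := by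
      intro e
      induction e with
      | _ x y => simp
    simp only [Function.comp_def, this]
    rw [Finset.sum_sym2_filter_not_isDiag Finset.univ fun e => w (a.sym2Map e)]
    refine Finset.sum_congr ?_ fun p _ => rfl
    ext p
    simpa using fun h => ne_of_lt h
  constructor
  · rintro ⟨s, hs, rfl⟩
    refine ⟨s.orderEmbOfFin hs.card_eq, fun u v huv => ?_, ?_⟩
    · exact hs.isClique (s.orderEmbOfFin_mem hs.card_eq u) (s.orderEmbOfFin_mem hs.card_eq v)
        fun h => huv.ne ((s.orderEmbOfFin hs.card_eq).injective h)
    · have := key (s.orderEmbOfFin hs.card_eq).toEmbedding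
      rw [Finset.map_orderEmbOfFin_univ] at this
      exact this
  · rintro ⟨a, ha, rfl⟩
    have hne : ∀ u v, u ≠ v → G.Adj (a u) (a v) := fun u v huv => by
      rcases lt_or_gt_of_ne huv with h | h
      exacts [ha u v h, (ha v u h).symm]
    have hinj : Function.Injective a := fun u v h => by
      by_contra huv
      exact (hne u v huv).ne h
    refine ⟨Finset.univ.map ⟨a, hinj⟩, ⟨?_, by simp⟩, (key ⟨a, hinj⟩).symm⟩
    intro x hx y hy hxy
    obtain ⟨u, -, rfl⟩ := Finset.mem_map.1 (Finset.mem_coe.1 hx)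
    obtain ⟨v, -, rfl⟩ := Finset.mem_map.1 (Finset.mem_coe.1 hy)
    exact hne u v fun h => hxy (by rw [h])

/-- A value that bounds all pair weights from below, and is attained unless it equals `big`, gives
the solution of the clique problem. -/
theorem isMinWeightCliqueOutput_of_min {W big : ℕ} (hw : ∀ e ∈ G.edgeSet, |w e| ≤ W)
    (hbig : 2 * k ^ 2 * W < big) {b : ℤ} (hb : b ≤ big)
    (hle : ∀ a : Fin k → ℕ, (∀ v, a v < N) → b ≤ pairWeight (shiftedWeight G w W big) a)
    (heq : b < big → ∃ a : Fin k → ℕ, (∀ v, a v < N) ∧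
      b = pairWeight (shiftedWeight G w W big) a) :
    IsMinWeightCliqueOutput G w k (if b < big then [b - pairCount k * W] else []) := by
  have hmem : ∀ m ∈ cliqueWeights G w k, b - pairCount k * W ≤ m ∧ b < big := by
    intro m hm
    obtain ⟨a, ha, rfl⟩ := mem_cliqueWeights_iff.1 hm
    have h1 := hle (fun v => a v) fun v => (a v).2
    have h2 := pairWeight_lt_of_adj hw hbig ha
    rw [pairWeight_of_adj hw ha] at h1
    have h3 := pairWeight_of_adj (big := big) hw ha
    constructor <;> omega
  split_ifs with h
  · refine .inr ⟨_, ⟨?_, fun m hm => (hmem m hm).1⟩, rfl⟩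
    obtain ⟨a, ha, hba⟩ := heq h
    have hlt : pairWeight (shiftedWeight G w W big)
        (fun v => ((⟨a v, ha v⟩ : Fin N) : ℕ)) < big := by
      rw [hba] at h; exact_mod_cast h
    have hadj := adj_of_pairWeight_lt hlt
    refine mem_cliqueWeights_iff.2 ⟨fun v => ⟨a v, ha v⟩, hadj, ?_⟩
    have : (pairWeight (shiftedWeight G w W big) a : ℤ) = _ :=
      pairWeight_of_adj (big := big) hw hadj
    rw [hba, this]
    ring
  · refine .inl ⟨Set.eq_empty_of_forall_notMem fun m hm => h (hmem m hm).2, rfl⟩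

end Clique

/-! ### Reading the encoding of a graph -/

section GraphAccess

open RAM Ex

variable {N : ℕ} (G : SimpleGraph (Fin N)) (w : Sym2 (Fin N) → ℤ)

theorem getD_encodeGraph_zero : (encodeGraph G w).getD 0 0 = N := rfl

open Classical in
theorem getD_encodeGraph (a b : Fin N) {j : ℕ} (hj : j < 2) :
    (encodeGraph G w).getD (2 * (a * N + b) + j + 1) 0 =
      (if G.Adj a b then [1, w s(a, b)] else [0, 0]).getD j 0 := by
  have h2 : ∀ u v : Fin N, (if G.Adj u v then [1, w s(u, v)] else [0, 0]).length = 2 := by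
    intro u v; split_ifs <;> rfl
  have hrow : ∀ u : Fin N, ((List.finRange N).flatMap fun v =>
      if G.Adj u v then [1, w s(u, v)] else [0, 0]).length = N * 2 := fun u => by
    rw [List.length_flatMap_of_uniform (W := 2) _ _ fun v _ => h2 u v, List.length_finRange]
  have hb : (b : ℕ) * 2 + j < N * 2 := by have := b.2; omega
  rw [encodeGraph, List.getD_cons_succ,
    show 2 * ((a : ℕ) * N + b) + j = a * (N * 2) + (b * 2 + j) by ring,
    List.getD_flatMap_of_uniform _ _ (fun u _ => hrow u) 0 (by simp) hb,
    List.getD_flatMap_of_uniform _ _ (fun v _ => h2 _ v) 0 (by simp) hj]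
  simp

theorem abs_getD_encodeGraph_le {M : ℕ} (hN : N ≤ M) (hM : 1 ≤ M)
    (hw : ∀ e ∈ G.edgeSet, |w e| ≤ M) (i : ℕ) : |(encodeGraph G w).getD i 0| ≤ M := by
  classical
  have hmem : ∀ z ∈ encodeGraph G w, |z| ≤ M := by
    intro z hz
    rw [encodeGraph, List.mem_cons, List.mem_flatMap] at hz
    rcases hz with rfl | ⟨u, -, hz⟩
    · simpa using hN
    · obtain ⟨v, -, hz⟩ := List.mem_flatMap.1 hz
      split_ifs at hz with h
      · simp only [List.mem_cons, List.not_mem_nil, or_false] at hz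
        rcases hz with rfl | rfl
        · simpa using hM
        · exact hw _ h
      · simp only [List.mem_cons, List.not_mem_nil, or_false, or_self] at hz
        simp [hz]
  rcases lt_or_ge i (encodeGraph G w).length with h | h
  · rw [List.getD_eq_getElem _ _ h]
    exact hmem _ (List.getElem_mem h)
  · rw [List.getD_eq_default _ _ h]
    simp

/-- `(N + 2) ^ c` -/
def shiftEx (c : ℕ) : Ex := pow (op .add (var 0) (const 2)) c

/-- `2 * k ^ 2 * (N + 2) ^ c + 1` -/
def bigEx (k c : ℕ) : Ex := op .add (op .mul (const (2 * k ^ 2 : ℕ)) (shiftEx c)) (const 1)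

/-- The shifted weight of a pair of vertices. -/
def weightEx (k c : ℕ) (a b : Ex) : Ex :=
  let p := op .add (op .mul (const 2) (op .add (op .mul a (var 0)) b)) (const 1)
  ite (inp p) (op .add (inp (op .add p (const 1))) (shiftEx c)) (bigEx k c)

variable {G w} {ρ : Fin 4 → ℤ} {μ : ℕ → ℤ} {l : List ℤ}

theorem eval_shiftEx (c : ℕ) (h0 : ρ 0 = N) : (shiftEx c).eval ρ μ l = ((N + 2) ^ c : ℕ) :=
  eval_pow (eval_add (y := 2) (by simpa [eval] using h0) (by simp [eval])) c

theorem eval_bigEx (k c : ℕ) (h0 : ρ 0 = N) :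
    (bigEx k c).eval ρ μ l = (2 * k ^ 2 * (N + 2) ^ c + 1 : ℕ) :=
  eval_add (y := 1) (eval_mul (by simp [eval]) (eval_shiftEx c h0)) (by simp [eval])

theorem computesWeight_weightEx {k c : ℕ} (hw : ∀ e ∈ G.edgeSet, |w e| ≤ ((N + 2) ^ c : ℕ)) :
    ComputesWeight (weightEx k c) N (encodeGraph G w)
      (shiftedWeight G w ((N + 2) ^ c) (2 * k ^ 2 * (N + 2) ^ c + 1)) := by
  classical
  intro ρ μ h0 e e' a b ha hb he he'
  -- The leading entry `N` and two entries per matrix cell put the flag of `(a, b)` at position `2 *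
  -- (a * N + b) + 1` and the weight right after it.
  set p := op .add (op .mul (const 2) (op .add (op .mul e (var 0)) e')) (const 1) with hpdef
  have hp : p.eval ρ μ (encodeGraph G w) = (2 * (a * N + b) + 0 + 1 : ℕ) :=
    eval_add (y := 1) (eval_mul (x := 2) (by simp [eval])
      (eval_add (eval_mul he (by simpa [eval] using h0)) he')) (by simp [eval])
  have hp1 : (op .add p (const 1)).eval ρ μ (encodeGraph G w) = (2 * (a * N + b) + 1 + 1 : ℕ) :=
    eval_add (y := 1) hp (by simp [eval])
  have hread : ∀ (q : Ex) (j : ℕ), j < 2 →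
      q.eval ρ μ (encodeGraph G w) = (2 * (a * N + b) + j + 1 : ℕ) →
      (inp q).eval ρ μ (encodeGraph G w) =
        (if G.Adj ⟨a, ha⟩ ⟨b, hb⟩ then [1, w s(⟨a, ha⟩, ⟨b, hb⟩)] else [0, 0]).getD j 0 := by
    intro q j hj hq
    rw [eval, hq, if_pos (by positivity), Int.toNat_natCast]
    exact getD_encodeGraph G w ⟨a, ha⟩ ⟨b, hb⟩ hj
  have r0 := hread p 0 (by omega) hp
  have r1 := hread _ 1 (by omega) hp1
  change (ite (inp p) (op .add (inp (op .add p (const 1))) (shiftEx c)) (bigEx k c)).eval ρ μ _ = _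
  rw [eval, r0]
  by_cases hadj : G.Adj ⟨a, ha⟩ ⟨b, hb⟩
  · rw [shiftedWeight_of_adj (a := ⟨a, ha⟩) (b := ⟨b, hb⟩) hadj]
    rw [if_pos hadj] at r1 ⊢
    have := (abs_le.1 (hw _ (G.mem_edgeSet.2 hadj))).1
    rw [if_pos (by simp), eval, r1, eval_shiftEx c h0, Int.toNat_of_nonneg (by omega)]
    rfl
  · rw [shiftedWeight_of_not_adj (a := ⟨a, ha⟩) (b := ⟨b, hb⟩) hadj]
    rw [if_neg hadj, if_neg (by simp), eval_bigEx k c h0]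

end GraphAccess

/-! ### The reduction -/

section Reduction

open RAM Ex

variable {n k : ℕ} (φ : FAQ n) (ψ : Fin k → Finset (Fin n)) (rep : Fin k → Fin n) (c : ℕ)

/-- A program for the clique problem, from a program `P` for the query. -/
noncomputable def cliqueProgram (P : Cmd) : Cmd :=
  minProgram (φ.head.card + 1) (accDatabase φ ψ (weightEx k c) (var 1))
    (scoreEx ψ (weightEx k c) (bigEx k c) φ.head rep (pairsOf φ ψ none)) (bigEx k c)
    (op .mul (const (pairCount k)) (shiftEx c)) P

noncomputable def cliqueProgramDeg : ℕ :=
  minProgramDeg (φ.head.card + 1) (accDatabase φ ψ (weightEx k c) (var 1))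
    (scoreEx ψ (weightEx k c) (bigEx k c) φ.head rep (pairsOf φ ψ none)) (bigEx k c)
    (op .mul (const (pairCount k)) (shiftEx c))

noncomputable def cliqueProgramFactor : ℕ :=
  minProgramFactor (φ.head.card + 1) (accDatabase φ ψ (weightEx k c) (var 1))
    (scoreEx ψ (weightEx k c) (bigEx k c) φ.head rep (pairsOf φ ψ none)) (bigEx k c)
    (op .mul (const (pairCount k)) (shiftEx c))

variable {φ ψ rep c}

/-- The same number `2 * k ^ 2 * (N + 2) ^ c + 1` serves as the cost of a non-edge, the penalty for
inconsistency and the cap of the minimum, so any defect makes a row irrelevant. -/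
theorem cliqueProgram_computes (hψ : IsCliqueEmbedding (insert φ.head φ.edges) ψ)
    (hrep : ∀ v ∈ meeting ψ φ.head, rep v ∈ ψ v ∩ φ.head) {N : ℕ} (hN : 0 < N)
    {G : SimpleGraph (Fin N)} {w : Sym2 (Fin N) → ℤ}
    (hw : ∀ e ∈ G.edgeSet, |w e| ≤ ((N + 2) ^ c : ℕ)) {wt : ℕ → ℕ → ℕ}
    (hwt : wt = shiftedWeight G w ((N + 2) ^ c) (2 * k ^ 2 * (N + 2) ^ c + 1))
    {L : List ((φ.head → ℕ) × ℕ)} (hL : IsListing L (φ.eval (graphDatabase φ ψ N wt)))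
    {B M B' : ℕ} {P : Cmd} {T : ℝ}
    (h : Computes B P (encodeDatabase (rows φ ψ N wt)) (encodeRows L) T)
    (hBM : B ≤ M) (hT : T ≤ M) (hNM : N + 2 ≤ M) (hbig : 2 * k ^ 2 * (N + 2) ^ c + 1 ≤ M)
    (hc : (N + 2) ^ c ≤ M) (hB' : M ^ cliqueProgramDeg φ ψ rep c ≤ B') :
    ∃ out, Computes B' (cliqueProgram φ ψ rep c P) (encodeGraph G w) out
      (cliqueProgramFactor φ ψ rep c * (T + 1)) ∧ IsMinWeightCliqueOutput G w k out := by
  obtain ⟨t, s₁, hexec, ht, hout⟩ := h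
  have hcw : ComputesWeight (weightEx k c) N (encodeGraph G w) wt :=
    hwt ▸ computesWeight_weightEx hw
  have hacc := accesses_accDatabase (φ := φ) (ψ := ψ) hN hcw
  obtain ⟨t', s', b, hexec', ht', hout', hb, hbS, hbE⟩ := minProgram_exec (B' := B') (M := M)
    (m := L.length) (N := N) (Big := (2 * k ^ 2 * (N + 2) ^ c + 1 : ℕ))
    (Shift := (pairCount k * (N + 2) ^ c : ℕ)) (inp' := encodeGraph G w)
    (e := accDatabase φ ψ (weightEx k c) (var 1))
    (sc := scoreEx ψ (weightEx k c) (bigEx k c) φ.head rep (pairsOf φ ψ none))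
    (big := bigEx k c) (shift := op .mul (const (pairCount k)) (shiftEx c))
    (S := fun i => if h : i < L.length then (L[i].2 + headWeight ψ N wt
      (2 * k ^ 2 * (N + 2) ^ c + 1) rep (pairsOf φ ψ none) φ.head (extendTuple L[i].1) : ℕ) else 0)
    hexec (Nat.succ_pos _) (by omega) hBM (by exact_mod_cast hN)
    (abs_getD_encodeGraph_le G w (by omega) (by omega)
      fun e he => (hw e he).trans (by exact_mod_cast hc))
    hB' (by exact_mod_cast ht.trans hT) rfl
    (fun ρ μ a h0 h1 => hacc ρ μ h0 _ _ (by simpa [eval] using h1))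
    (by rw [hout, length_encodeRows])
    (fun i hi => ⟨by rw [dif_pos hi]; positivity, fun ρ μ h0 h2 hμ => by
      rw [dif_pos hi]
      exact eval_scoreEx hN hcw (fun ρ μ h0 => eval_bigEx k c h0) h0 hi h2
        (by rw [hout] at hμ; exact hμ)⟩)
    (fun ρ μ h0 => eval_bigEx k c h0)
    (fun ρ μ h0 => eval_mul (by simp [eval]) (eval_shiftEx c h0))
    (by positivity) (by exact_mod_cast hbig)
  refine ⟨_, ⟨t', s', hexec', ?_, hout'⟩, ?_⟩
  · have h1 : (t' : ℝ) ≤ cliqueProgramFactor φ ψ rep c * ((t : ℝ) + 1) := by exact_mod_cast ht'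
    exact h1.trans (mul_le_mul_of_nonneg_left (by linarith) (by positivity))
  · rw [Nat.cast_mul]
    refine isMinWeightCliqueOutput_of_min hw (Nat.lt_succ_self _) hb (fun a ha => ?_) fun hlt => ?_
    · obtain ⟨p, hp, hle⟩ := exists_row_le (big := 2 * k ^ 2 * (N + 2) ^ c + 1) hψ hN hrep hL ha
      obtain ⟨i, hi, rfl⟩ := List.getElem_of_mem hp
      have := hbS i hi
      rw [dif_pos hi] at this
      rw [← hwt]
      exact this.trans (by exact_mod_cast hle)
    · rcases hbE with h | ⟨i, hi, h⟩
      · omega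
      · rw [dif_pos hi] at h
        rw [h] at hlt
        obtain ⟨a, ha, heq⟩ := exists_pairWeight_eq hψ hN hrep hL (List.getElem_mem hi)
          (by exact_mod_cast hlt)
        exact ⟨a, ha, by rw [h, ← hwt, heq]⟩

end Reduction

/-! ### Size and time bounds -/

section Bounds

variable {n k : ℕ} {φ : FAQ n} {ψ : Fin k → Finset (Fin n)} {N : ℕ} {wt : ℕ → ℕ → ℕ}

theorem weakEdgeDepth_le_headWeakEdgeDepth (J : φ.edges) :
    weakEdgeDepth ψ J.1 ≤ headWeakEdgeDepth φ ψ :=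
  Finset.le_sup (f := weakEdgeDepth ψ) J.2

theorem exists_weakEdgeDepth_pos (hψ : ∀ v, (ψ v).Nonempty) (hk : 0 < k) :
    ∃ J : φ.edges, 0 < weakEdgeDepth ψ J.1 := by
  obtain ⟨i, hi⟩ := hψ ⟨0, hk⟩
  obtain ⟨J, hJ, hiJ⟩ := φ.cover i
  exact ⟨⟨J, hJ⟩, Finset.card_pos.2 ⟨⟨0, hk⟩, mem_meeting.2 ⟨i, Finset.mem_inter.2 ⟨hi, hiJ⟩⟩⟩⟩

theorem size_graphDatabase_le (hN : 0 < N) : (graphDatabase φ ψ N wt).size ≤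
    (φ.edges.card + 1) * N ^ headWeakEdgeDepth φ ψ := by
  rw [size_graphDatabase φ ψ wt hN]
  refine (Finset.sum_le_card_nsmul _ _ _ fun J _ =>
    Nat.pow_le_pow_right hN (weakEdgeDepth_le_headWeakEdgeDepth J)).trans ?_
  rw [Finset.card_univ, Fintype.card_coe, smul_eq_mul]
  exact Nat.mul_le_mul_right _ (Nat.le_succ _)

/-- Constants and annotations must be polynomial in `|D|`, whereas the construction bounds them by
polynomials in `N`. -/
theorem le_size_graphDatabase (hN : 0 < N) (hψ : ∀ v, (ψ v).Nonempty) (hk : 0 < k) :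
    N ≤ (graphDatabase φ ψ N wt).size := by
  obtain ⟨J, hJ⟩ := exists_weakEdgeDepth_pos (φ := φ) hψ hk
  rw [size_graphDatabase φ ψ wt hN]
  calc N ≤ N ^ weakEdgeDepth ψ J.1 := Nat.le_self_pow hJ.ne' N
    _ ≤ _ := Finset.single_le_sum (f := fun J : φ.edges => N ^ weakEdgeDepth ψ J.1)
      (fun _ _ => Nat.zero_le _) (Finset.mem_univ J)

/-- Constant factors are absorbed into exponents through `q ≤ b ^ q`. -/
theorem le_pow_of_le_mul_pow {a b c q : ℕ} (hb : 2 ≤ b) (h : a ≤ q * b ^ c) :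
    a ≤ b ^ (q + c) := by
  have h1 : q ≤ b ^ q := (Nat.lt_pow_self (by omega)).le
  rw [pow_add]
  exact h.trans (Nat.mul_le_mul_right _ h1)

theorem rowWeight_le {big : ℕ} (hwt : ∀ a b, wt a b ≤ big) (J : φ.edges) (r : ℕ) :
    rowWeight φ ψ N wt J r ≤ k ^ 2 * big := by
  refine (Finset.sum_le_card_nsmul _ _ _ fun p _ => hwt _ _).trans ?_
  refine Nat.mul_le_mul_right _ ((Finset.card_filter_le _ _).trans (le_of_eq ?_))
  simp [sq]

theorem rows_bounded {c : ℕ} (hN : 0 < N) (hψ : ∀ v, (ψ v).Nonempty) (hk : 0 < k)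
    (hwt : ∀ a b, wt a b ≤ 2 * k ^ 2 * (N + 2) ^ c + 1) (J : φ.edges)
    {p : (J.1 → ℕ) × ℕ} (hp : p ∈ rows φ ψ N wt J) :
    (∀ i, p.1 i ≤ ((graphDatabase φ ψ N wt).size + 2) ^ (k ^ 2 * (2 * k ^ 2 + 1) + (c + k))) ∧
      p.2 ≤ ((graphDatabase φ ψ N wt).size + 2) ^ (k ^ 2 * (2 * k ^ 2 + 1) + (c + k)) := by
  have hsize := le_size_graphDatabase (φ := φ) (wt := wt) hN hψ hk
  obtain ⟨r, hr, rfl⟩ := List.mem_map.1 hp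
  constructor
  · intro i
    calc rowTuple ψ N J.1 r i ≤ N ^ k := (code_lt ψ (rowDigit_lt ψ hN J.1 r) i).le
      _ ≤ ((graphDatabase φ ψ N wt).size + 2) ^ k := Nat.pow_le_pow_left (by omega) k
      _ ≤ _ := Nat.pow_le_pow_right (by omega) (by omega)
  · refine le_pow_of_le_mul_pow (by omega) ((rowWeight_le hwt J r).trans ?_)
    have h1 : 1 ≤ (N + 2) ^ c := Nat.one_le_pow _ _ (by omega)
    calc k ^ 2 * (2 * k ^ 2 * (N + 2) ^ c + 1)
        ≤ k ^ 2 * (2 * k ^ 2 * (N + 2) ^ c + (N + 2) ^ c) := by gcongr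
      _ = k ^ 2 * (2 * k ^ 2 + 1) * (N + 2) ^ c := by ring
      _ ≤ k ^ 2 * (2 * k ^ 2 + 1) * (N + 2) ^ (c + k) := by gcongr <;> omega
      _ ≤ _ := by gcongr

theorem rpow_le_mul_rpow {X s N p q : ℝ} {e : ℕ} (hX : 1 ≤ X) (hs : 0 ≤ s) (hN : 0 ≤ N)
    (hle : X ≤ s * N ^ e) (hpq : p ≤ q) (hq : 0 ≤ q) : X ^ p ≤ s ^ q * N ^ ((e : ℝ) * q) :=
  calc X ^ p ≤ X ^ q := Real.rpow_le_rpow_of_exponent_le hX hpq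
    _ ≤ (s * N ^ e) ^ q := Real.rpow_le_rpow (by linarith) hle hq
    _ = s ^ q * N ^ ((e : ℝ) * q) := by
      rw [Real.mul_rpow hs (by positivity), ← Real.rpow_natCast, ← Real.rpow_mul hN]

/-- Sizes are only bounded from above, which is useless under a negative exponent. Truncating `ε` to
`min ε x` and `ε'` to `min ε' y` makes the exponents nonnegative, and can only increase them, which
is allowed as the bases are at least 1. -/
theorem time_le {x y ε ε' C : ℝ} {d d' s X Y : ℕ} (hN : 1 ≤ N) (hX : X ≤ s * N ^ d) (hs : 1 ≤ s)
    (hY : Y ≤ N ^ d') {κ : ℝ} (hxy : x * d + y * d' ≤ κ) :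
    C * ((max 1 (X : ℝ)) ^ (x - ε) * (max 1 (Y : ℝ)) ^ (y - ε')) ≤
      |C| * (s : ℝ) ^ (x - min ε x) * (N : ℝ) ^ (κ - (d * min ε x + d' * min ε' y)) := by
  have hN' : (1 : ℝ) ≤ N := by exact_mod_cast hN
  have hs' : (1 : ℝ) ≤ s := by exact_mod_cast hs
  have h1 : max 1 (X : ℝ) ≤ s * (N : ℝ) ^ d := by
    refine max_le ?_ (by exact_mod_cast hX)
    have := one_le_pow₀ (n := d) hN'
    nlinarith
  have h2 : max 1 (Y : ℝ) ≤ 1 * (N : ℝ) ^ d' := by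
    rw [one_mul]
    exact max_le (one_le_pow₀ hN') (by exact_mod_cast hY)
  have hX' := rpow_le_mul_rpow (p := x - ε) (q := x - min ε x) (le_max_left 1 (X : ℝ))
    (by linarith) (by linarith) h1 (by linarith [min_le_left ε x]) (by linarith [min_le_right ε x])
  have hY' := rpow_le_mul_rpow (p := y - ε') (q := y - min ε' y) (le_max_left 1 (Y : ℝ))
    zero_le_one (by linarith) h2 (by linarith [min_le_left ε' y])
    (by linarith [min_le_right ε' y])
  rw [Real.one_rpow, one_mul] at hY'
  have h0X : 0 ≤ (max 1 (X : ℝ)) ^ (x - ε) := by positivity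
  have h0Y : 0 ≤ (max 1 (Y : ℝ)) ^ (y - ε') := by positivity
  calc C * ((max 1 (X : ℝ)) ^ (x - ε) * (max 1 (Y : ℝ)) ^ (y - ε'))
      ≤ |C| * ((max 1 (X : ℝ)) ^ (x - ε) * (max 1 (Y : ℝ)) ^ (y - ε')) :=
        mul_le_mul_of_nonneg_right (le_abs_self C) (by positivity)
    _ ≤ |C| * (((s : ℝ) ^ (x - min ε x) * (N : ℝ) ^ ((d : ℝ) * (x - min ε x))) *
          (N : ℝ) ^ ((d' : ℝ) * (y - min ε' y))) := by gcongr
    _ = |C| * (s : ℝ) ^ (x - min ε x) *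
          (N : ℝ) ^ ((d : ℝ) * (x - min ε x) + (d' : ℝ) * (y - min ε' y)) := by
        rw [Real.rpow_add (by linarith)]; ring
    _ ≤ _ := by
        gcongr
        linarith

end Bounds

theorem mainTheorem7 {n k : ℕ} (hk : 3 ≤ k) (φ : FAQ n) (ψ : Fin k → Finset (Fin n))
    (hψ : IsCliqueEmbedding (insert φ.head φ.edges) ψ)
    (x y : ℝ) (hx : 0 < x) (hy : 0 < y)
    (hxy : x * headWeakEdgeDepth φ ψ + y * edgeDepth ψ φ.head ≤ k)
    (ε ε' : ℝ) (hε : 0 ≤ ε) (hε' : 0 ≤ ε') (hpos : 0 < ε + ε')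
    (hdeg : edgeDepth ψ φ.head = 0 → 0 < ε)
    (hconj : MinWeightCliqueConjecture k) :
    ¬ φ.TropicalInTime fun N M =>
        (max 1 (N : ℝ)) ^ (x - ε) * (max 1 (M : ℝ)) ^ (y - ε') := by
  intro hφ
  have hk0 : 0 < k := by omega
  set wed := headWeakEdgeDepth φ ψ with hwed
  set dep := edgeDepth ψ φ.head with hdep
  -- The exponent saved by the reduction. It is positive because `wed > 0`, and because `ε = 0`
  -- forces both `ε' > 0` and `dep > 0`.
  set δ : ℝ := wed * min ε x + dep * min ε' y with hδdef
  have hwed0 : 0 < wed := by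
    obtain ⟨J, hJ⟩ := exists_weakEdgeDepth_pos (φ := φ) hψ.nonempty hk0
    exact hJ.trans_le (weakEdgeDepth_le_headWeakEdgeDepth J)
  have hδ : 0 < δ := by
    have h1 : 0 ≤ min ε x := le_min hε hx.le
    have h2 : 0 ≤ min ε' y := le_min hε' hy.le
    have hw : (0 : ℝ) < wed := by exact_mod_cast hwed0
    rcases hε.lt_or_eq with h | h
    · have : 0 < min ε x := lt_min h hx
      positivity
    · have hd : 0 < dep := Nat.pos_of_ne_zero fun h0 => (hdeg h0).ne h
      have : 0 < min ε' y := lt_min (by linarith) hy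
      positivity
  have hδk : 0 ≤ (k : ℝ) - δ := by
    have h1 : (wed : ℝ) * min ε x ≤ wed * x := by gcongr; exact min_le_right _ _
    have h2 : (dep : ℝ) * min ε' y ≤ dep * y := by gcongr; exact min_le_right _ _
    linarith
  refine hconj ⟨δ, hδ, fun c => ?_⟩
  obtain ⟨P, d, C, hP⟩ := hφ (k ^ 2 * (2 * k ^ 2 + 1) + (c + k))
  obtain ⟨rep, hrep⟩ : ∃ rep : Fin k → Fin n,
      ∀ v ∈ meeting ψ φ.head, rep v ∈ ψ v ∩ φ.head := by
    have : ∀ v, ∃ i, v ∈ meeting ψ φ.head → i ∈ ψ v ∩ φ.head := fun v => by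
      by_cases hv : v ∈ meeting ψ φ.head
      · obtain ⟨i, hi⟩ := mem_meeting.1 hv
        exact ⟨i, fun _ => hi⟩
      · exact ⟨(hψ.nonempty v).choose, fun h => absurd h hv⟩
    exact ⟨fun v => (this v).choose, fun v => (this v).choose_spec⟩
  set s := φ.edges.card + 1 with hs
  set C₂ : ℝ := |C| * (s : ℝ) ^ (x - min ε x) with hC₂
  have hC₂0 : 0 ≤ C₂ := by positivity
  -- All quantities have to fit below `(N + 2) ^ m`: the summands cater for the register bound of
  -- `P`, its running time, `big`, and `N + 2` itself.
  set m := ((s + 2) + wed) * d + (⌈C₂⌉₊ + k) + ((2 * k ^ 2 + 1) + c) + 1 with hm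
  set K := cliqueProgramFactor φ ψ rep c
  -- The `+ 1` turns the additive overhead into a multiple of `N ^ (k - δ) ≥ 1`; the `+ 4` pays for
  -- the empty graph.
  refine ⟨cliqueProgram φ ψ rep c P, m * cliqueProgramDeg φ ψ rep c, K * (C₂ + 1) + 4,
    fun N G w hw => ?_⟩
  rcases Nat.eq_zero_or_pos N with rfl | hN
  · obtain ⟨t, st, hex, ht, hout⟩ := RAM.minProgram_exec_of_nonpos
      (B := (0 + 2) ^ (m * cliqueProgramDeg φ ψ rep c))
      (l := encodeGraph G w) (W := φ.head.card + 1)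
      (e := accDatabase φ ψ (weightEx k c) (.var 1))
      (sc := scoreEx ψ (weightEx k c) (bigEx k c) φ.head rep (pairsOf φ ψ none)) (big := bigEx k c)
      (shift := .op .mul (.const (pairCount k)) (shiftEx c)) (p := P)
      (by rw [getD_encodeGraph_zero]; simp) (by rw [getD_encodeGraph_zero]; simp)
    refine ⟨[], ⟨t, st, hex, ?_, hout⟩, .inl ⟨?_, rfl⟩⟩
    · have : (t : ℝ) ≤ 4 := by exact_mod_cast ht
      have : (0 : ℝ) ≤ K * (C₂ + 1) := by positivity
      simp only [Nat.cast_zero, max_eq_left zero_le_one, Real.one_rpow, mul_one]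
      linarith
    · refine Set.eq_empty_of_forall_notMem ?_
      rintro _ ⟨q, hq, -⟩
      have h1 := hq.card_eq
      have h2 := q.card_le_univ
      rw [Fintype.card_fin] at h2
      omega
  · set big := 2 * k ^ 2 * (N + 2) ^ c + 1 with hbig
    set wt := shiftedWeight G w ((N + 2) ^ c) big with hwt
    have hone : 1 ≤ (N + 2) ^ c := Nat.one_le_pow _ _ (by omega)
    have hwtle : ∀ a b, wt a b ≤ big := shiftedWeight_le hw (by
      have : 1 ≤ k ^ 2 := Nat.one_le_pow _ _ hk0
      rw [hbig]; nlinarith)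
    obtain ⟨L, hL, hcomp⟩ := hP (graphDatabase φ ψ N wt) (rows φ ψ N wt)
      (isListing_rows φ ψ wt hN) fun J p hp => rows_bounded hN hψ.nonempty hk0 hwtle J hp
    have hsize := size_graphDatabase_le (φ := φ) (ψ := ψ) (wt := wt) hN
    have htime := time_le (x := x) (y := y) (ε := ε) (ε' := ε') (C := C) (κ := k) hN hsize
      (Nat.succ_pos _) (card_support_eval_le (φ := φ) (ψ := ψ) (wt := wt) hN) hxy
    rw [← hδdef, ← hC₂] at htime
    have hN1 : (1 : ℝ) ≤ N := by exact_mod_cast hN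
    have hmax : max 1 (N : ℝ) = N := max_eq_right hN1
    have hmono : ∀ {j}, j ≤ m → (N + 2) ^ j ≤ (N + 2) ^ m :=
      fun hj => Nat.pow_le_pow_right (by omega) hj
    have hpow1 : 1 ≤ (N : ℝ) ^ ((k : ℝ) - δ) := Real.one_le_rpow hN1 hδk
    have hB : ((graphDatabase φ ψ N wt).size + 2) ^ d ≤ (N + 2) ^ m := by
      refine le_trans ?_ (hmono (j := ((s + 2) + wed) * d) (by omega))
      rw [pow_mul]
      refine Nat.pow_le_pow_left (le_pow_of_le_mul_pow (by omega) ?_) d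
      have h1 : N ^ wed ≤ (N + 2) ^ wed := Nat.pow_le_pow_left (by omega) _
      have h2 : 1 ≤ (N + 2) ^ wed := Nat.one_le_pow _ _ (by omega)
      calc _ ≤ s * N ^ wed + 2 := Nat.add_le_add_right hsize 2
        _ ≤ s * (N + 2) ^ wed + 2 * (N + 2) ^ wed := by gcongr; omega
        _ = _ := by ring
    have hT : C₂ * (N : ℝ) ^ ((k : ℝ) - δ) ≤ ((N + 2) ^ m : ℕ) := by
      have h1 : ⌈C₂⌉₊ * (N + 2) ^ k ≤ (N + 2) ^ m :=
        (le_pow_of_le_mul_pow (by omega) le_rfl).trans (hmono (by omega))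
      have h2 : (N : ℝ) ^ ((k : ℝ) - δ) ≤ ((N : ℝ) + 2) ^ k := by
        calc (N : ℝ) ^ ((k : ℝ) - δ) ≤ (N : ℝ) ^ (k : ℝ) :=
              Real.rpow_le_rpow_of_exponent_le hN1 (by linarith)
          _ = (N : ℝ) ^ k := Real.rpow_natCast _ _
          _ ≤ _ := by gcongr; linarith
      calc _ ≤ (⌈C₂⌉₊ : ℝ) * ((N : ℝ) + 2) ^ k := by
            gcongr
            exact Nat.le_ceil _
        _ ≤ _ := by exact_mod_cast h1
    have hbigM : big ≤ (N + 2) ^ m := by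
      refine le_trans (le_pow_of_le_mul_pow (q := 2 * k ^ 2 + 1) (c := c) (by omega) ?_)
        (hmono (by omega))
      rw [hbig, add_mul, one_mul]
      omega
    obtain ⟨out, ⟨t, st, hex, ht, hout⟩, hmin⟩ := cliqueProgram_computes hψ hrep hN hw hwt hL hcomp
      (M := (N + 2) ^ m) (B' := (N + 2) ^ (m * cliqueProgramDeg φ ψ rep c)) hB (htime.trans hT)
      (by simpa using hmono (j := 1) (by omega)) hbigM (hmono (by omega)) (by rw [pow_mul])
    refine ⟨out, ⟨t, st, hex, ht.trans ?_, hout⟩, hmin⟩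
    change _ ≤ _ * (max 1 (N : ℝ)) ^ ((k : ℝ) - δ)
    rw [hmax]
    calc (K : ℝ) * (C * _ + 1)
        ≤ K * (C₂ * (N : ℝ) ^ ((k : ℝ) - δ) + (N : ℝ) ^ ((k : ℝ) - δ)) := by gcongr
      _ = K * (C₂ + 1) * (N : ℝ) ^ ((k : ℝ) - δ) := by ring
      _ ≤ _ := by gcongr; linarith
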